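/- Let $S=\bigoplus_{i\ge 0}S_i$ be a Noetherian commutative $\mathbb N$-graded ring with $S_0$ local, and let $\mathfrak m$ be its homogeneous maximal ideal (generated by the maximal ideal of $S_0$ and $S_{>0}$). Graded modules are $\mathbb Z$-graded, and $M(b)_n=M_{n+b}$. For $a\in\mathbb Z$, a *degree $a$ differential module* is a graded $S$-module $D$ with a homogeneous $S$-linear map $d:D\to D(a)$ such that $d^2=0$; its homology is $H(D)=\ker d/\operatorname{im} d$, graded as a subquotient of $D$. A morphism is a degree $0$ $S$-linear map commuting with the differentials, and it is a quasi-isomorphism if it induces an isomorphism on homology. The *degree $a$ fold* of a homogeneous complex $\mathbf F=(F_0\xleftarrow{\partial}F_1\xleftarrow{\partial}\cdots)$ (differentials of internal degree $0$) is $\operatorname{Fold}_a(\mathbf F)=\big(\bigoplus_i F_i(ia),\partial\big)$. A *degree $a$ free flag* is a degree $a$ differential module of the form $\bigoplus_{i\ge0}G_i$ with $G_i$ free graded modules and $d(G_j)\subseteq\bigoplus_{i<j}G_i$. Its *anchor* is the complex formed by the components $G_i\to G_{i-1}$ of $d$, with $G_i$ twisted by $-ia$ so that these have internal degree $0$; the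 flag is *anchored on* $\mathbf F$ if its anchor is isomorphic to $\mathbf F$. The complex $\mathbf F$ is *$a$-rigid* if every degree $a$ free flag anchored on $\mathbf F$ is isomorphic to $\operatorname{Fold}_a(\mathbf F)$ as a degree $a$ differential module. **Theorem.** 1. Let $\mathbf F$ be a homogeneous complex $F_0\leftarrow F_1\leftarrow\cdots\leftarrow F_\ell\leftarrow 0$ of finitely generated free graded $S$-modules whose homology has finite length. Then there is $N$ such that $\mathbf F$ is $a$-rigid for all integers $a$ with $|a|\ge N$ (in particular for all $a\gg0$). 2. Let $M$ be a graded $S$-module of finite length. Then there is $N$ such that for all integers $a$ with $|a|\ge N$, every minimal graded free resolution $\mathbf F$ of $M$, and every degree $a$ differential module $D$ whose homology is isomorphic to $M$ as a graded module, there is a quasi-isomorphism $\operatorname{Fold}_a(\mathbf F)\to D$. -/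

import Mathlib

open scoped DirectSum

universe u u' v w

noncomputable section

namespace GradedDiff

variable {S : Type u} [CommRing S]

/-- `ℳ` is a `ℤ`-grading of the `S`-module `M`, where `S` is graded by `𝒜`:
`M = ⨁ n, ℳ n` as an abelian group and `𝒜 i • ℳ n ⊆ ℳ (n + i)`. -/
structure IsGradedModule (𝒜 : ℕ → AddSubgroup S) {M : Type v} [AddCommGroup M] [Module S M]
    (ℳ : ℤ → AddSubgroup M) : Prop where
  isInternal : DirectSum.IsInternal ℳ
  smul_mem : ∀ (i : ℕ) (n : ℤ) (s : S) (x : M), s ∈ 𝒜 i → x ∈ ℳ n → s • x ∈ ℳ (n + i)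

/-- A linear isomorphism of graded modules that identifies the two gradings (degree `0`). -/
def IsGradedEquiv {M : Type v} [AddCommGroup M] [Module S M] {N : Type w} [AddCommGroup N]
    [Module S N] (ℳ : ℤ → AddSubgroup M) (𝒩 : ℤ → AddSubgroup N) (e : M ≃ₗ[S] N) : Prop :=
  ∀ (n : ℤ) (x : M), x ∈ ℳ n ↔ e x ∈ 𝒩 n

/-- The grading of the twist `M(b)`, with `M(b)_n = M_{n + b}`. -/
def twist {M : Type v} [AddCommGroup M] (ℳ : ℤ → AddSubgroup M) (b : ℤ) : ℤ → AddSubgroup M :=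
  fun n => ℳ (n + b)

/-- The grading of a direct sum: `(⨁ i, X_i)_n = ⨁ i, (X_i)_n`. -/
def sumGrading {X : ℕ → Type v} [∀ i, AddCommGroup (X i)] (g : ∀ i, ℤ → AddSubgroup (X i)) :
    ℤ → AddSubgroup (⨁ i, X i) := fun n =>
  { carrier := {x | ∀ i, x i ∈ g i n}
    zero_mem' := fun i => (g i n).zero_mem
    add_mem' := fun hx hy i => (g i n).add_mem (hx i) (hy i)
    neg_mem' := fun hx i => (g i n).neg_mem (hx i) }

theorem mem_sumGrading {X : ℕ → Type v} [∀ i, AddCommGroup (X i)]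
    {g : ∀ i, ℤ → AddSubgroup (X i)} {n : ℤ} {x : ⨁ i, X i} :
    x ∈ sumGrading g n ↔ ∀ i, x i ∈ g i n := Iff.rfl

theorem of_mem_sumGrading {X : ℕ → Type v} [∀ i, AddCommGroup (X i)]
    {g : ∀ i, ℤ → AddSubgroup (X i)} {n : ℤ} {i : ℕ} {x : X i} (hx : x ∈ g i n) :
    DirectSum.of X i x ∈ sumGrading g n := by
  intro j
  by_cases h : i = j
  · subst h
    rwa [DirectSum.of_eq_same]
  · rw [DirectSum.of_eq_of_ne _ _ _ (Ne.symm h)]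
    exact (g j n).zero_mem

theorem IsGradedModule.twist {𝒜 : ℕ → AddSubgroup S} {M : Type v} [AddCommGroup M] [Module S M]
    {ℳ : ℤ → AddSubgroup M} (h : IsGradedModule 𝒜 ℳ) (b : ℤ) :
    IsGradedModule 𝒜 (twist ℳ b) := by
  refine ⟨⟨?_, ?_⟩, fun i n s x hs hx => ?_⟩
  · let g : ∀ n, GradedDiff.twist ℳ b n →+ ⨁ n, ℳ n := fun n =>
      DirectSum.of (fun n => ℳ n) (n + b)
    let f : (⨁ n, GradedDiff.twist ℳ b n) →+ ⨁ n, ℳ n := DirectSum.toAddMonoid g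
    have hof : ∀ n x, f (DirectSum.of (fun n => GradedDiff.twist ℳ b n) n x) =
        DirectSum.of (fun n => ℳ n) (n + b) x := fun n x => DirectSum.toAddMonoid_of g n x
    have h1 : ∀ z, DirectSum.coeAddMonoidHom ℳ (f z) =
        DirectSum.coeAddMonoidHom (GradedDiff.twist ℳ b) z := by
      intro z
      induction z using DirectSum.induction_on with
      | zero => simp
      | of n x =>
        rw [hof, DirectSum.coeAddMonoidHom_of]
        exact DirectSum.coeAddMonoidHom_of ℳ _ _
      | add x y hx hy => simp only [map_add, hx, hy]
    have h2 : ∀ z n, ((f z) (n + b) : M) = z n := by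
      intro z n
      induction z using DirectSum.induction_on with
      | zero => simp
      | of m x =>
        rw [hof]
        by_cases hmn : m = n
        · subst hmn
          rw [DirectSum.of_eq_same]
          exact congrArg Subtype.val (DirectSum.of_eq_same (β := fun n => ℳ n) (m + b) x)
        · rw [DirectSum.of_eq_of_ne _ _ _ (Ne.symm hmn)]
          exact congrArg Subtype.val (DirectSum.of_eq_of_ne (β := fun n => ℳ n) (m + b) (n + b) x
            (fun hc => hmn (by omega)))
      | add x y hx hy =>
        rw [map_add, DirectSum.add_apply, DirectSum.add_apply]
        push_cast
        rw [hx, hy]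
    intro z z' hz
    have hf : f z = f z' := h.isInternal.1 (by rw [h1, h1, hz])
    refine DFinsupp.ext fun n => Subtype.ext ?_
    rw [← h2 z n, ← h2 z' n, hf]
  · intro x
    obtain ⟨y, rfl⟩ := h.isInternal.2 x
    induction y using DirectSum.induction_on with
    | zero => exact ⟨0, by simp⟩
    | of n x =>
      refine ⟨DirectSum.of (fun n => GradedDiff.twist ℳ b n) (n - b) ⟨x, ?_⟩, ?_⟩
      · show (x : M) ∈ ℳ (n - b + b)
        rw [sub_add_cancel]
        exact x.2
      · rw [DirectSum.coeAddMonoidHom_of, DirectSum.coeAddMonoidHom_of]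
    | add x y hx hy =>
      obtain ⟨x', hx⟩ := hx
      obtain ⟨y', hy⟩ := hy
      exact ⟨x' + y', by rw [map_add, map_add, hx, hy]⟩
  · have := h.smul_mem i (n + b) s x hs hx
    rw [show n + b + i = n + i + b by ring] at this
    exact this

theorem IsGradedModule.sum {𝒜 : ℕ → AddSubgroup S} {X : ℕ → Type v} [∀ i, AddCommGroup (X i)]
    [∀ i, Module S (X i)] {g : ∀ i, ℤ → AddSubgroup (X i)}
    (h : ∀ i, IsGradedModule 𝒜 (g i)) : IsGradedModule 𝒜 (sumGrading g) := by
  refine ⟨⟨?_, ?_⟩, fun i n s x hs hx j => ?_⟩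
  · let p : ∀ i n, sumGrading g n →+ g i n := fun i n =>
      { toFun := fun x => ⟨(x : ⨁ i, X i) i, x.2 i⟩
        map_zero' := rfl
        map_add' := fun _ _ => rfl }
    let f : ∀ i, (⨁ n, sumGrading g n) →+ ⨁ n, g i n := fun i => DirectSum.map (p i)
    have h1 : ∀ i z, DirectSum.coeAddMonoidHom (g i) (f i z) =
        DirectSum.coeAddMonoidHom (sumGrading g) z i := by
      intro i z
      induction z using DirectSum.induction_on with
      | zero => simp
      | of n x =>
        simp only [f, DirectSum.map_of]
        rw [DirectSum.coeAddMonoidHom_of, DirectSum.coeAddMonoidHom_of]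
        rfl
      | add x y hx hy => rw [map_add, map_add, hx, hy, map_add, DirectSum.add_apply]
    intro z z' hz
    refine DFinsupp.ext fun n => Subtype.ext (DFinsupp.ext fun i => ?_)
    have hf : f i z = f i z' := (h i).isInternal.1 (by rw [h1, h1, hz])
    exact congrArg (fun y : ⨁ n, g i n => ((y n : g i n) : X i)) hf
  · intro x
    induction x using DirectSum.induction_on with
    | zero => exact ⟨0, by simp⟩
    | of i x =>
      obtain ⟨y, rfl⟩ := (h i).isInternal.2 x
      induction y using DirectSum.induction_on with
      | zero => exact ⟨0, by simp⟩
      | of n x =>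
        refine ⟨DirectSum.of (fun n => sumGrading g n) n
          ⟨DirectSum.of X i x, of_mem_sumGrading x.2⟩, ?_⟩
        rw [DirectSum.coeAddMonoidHom_of, DirectSum.coeAddMonoidHom_of]
      | add x y hx hy =>
        obtain ⟨x', hx⟩ := hx
        obtain ⟨y', hy⟩ := hy
        exact ⟨x' + y', by rw [map_add, map_add, map_add, hx, hy]⟩
    | add x y hx hy =>
      obtain ⟨x', hx⟩ := hx
      obtain ⟨y', hy⟩ := hy
      exact ⟨x' + y', by rw [map_add, hx, hy]⟩
  · exact (h j).smul_mem i n s _ hs (hx j)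

/-- A homogeneous complex `X 0 ← X 1 ← X 2 ← ⋯` of graded `S`-modules: the differentials are
`S`-linear of internal degree `0`. -/
structure GradedComplex (𝒜 : ℕ → AddSubgroup S) where
  X : ℕ → Type v
  [addCommGroup : ∀ i, AddCommGroup (X i)]
  [module : ∀ i, Module S (X i)]
  gr : ∀ i, ℤ → AddSubgroup (X i)
  isGraded : ∀ i, IsGradedModule 𝒜 (gr i)
  d : ∀ i, X (i + 1) →ₗ[S] X i
  d_comp_d : ∀ i, d i ∘ₗ d (i + 1) = 0
  d_mem : ∀ (i : ℕ) (n : ℤ) (x : X (i + 1)), x ∈ gr (i + 1) n → d i x ∈ gr i n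

attribute [instance] GradedComplex.addCommGroup GradedComplex.module

/-- A degree `a` differential module: a graded `S`-module `D` with an `S`-linear square-zero
endomorphism `d : D → D(a)`. -/
structure GradedDM (𝒜 : ℕ → AddSubgroup S) (a : ℤ) where
  carrier : Type v
  [addCommGroup : AddCommGroup carrier]
  [module : Module S carrier]
  gr : ℤ → AddSubgroup carrier
  isGraded : IsGradedModule 𝒜 gr
  d : carrier →ₗ[S] carrier
  d_comp_d : d ∘ₗ d = 0
  d_mem : ∀ (n : ℤ) (x : carrier), x ∈ gr n → d x ∈ gr (n + a)

attribute [instance] GradedDM.addCommGroup GradedDM.module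

namespace GradedDM

variable {𝒜 : ℕ → AddSubgroup S} {a : ℤ}

/-- The homology `ker d / im d`. -/
abbrev Homology (D : GradedDM.{u, v} 𝒜 a) : Type v :=
  LinearMap.ker D.d ⧸ (LinearMap.range D.d).submoduleOf (LinearMap.ker D.d)

/-- The grading of the homology: `H(D)_n` consists of the classes of the cycles in `D_n`. -/
def homologyGr (D : GradedDM.{u, v} 𝒜 a) (n : ℤ) : AddSubgroup D.Homology :=
  ((D.gr n).comap (LinearMap.ker D.d).subtype.toAddMonoidHom).map
    ((LinearMap.range D.d).submoduleOf (LinearMap.ker D.d)).mkQ.toAddMonoidHom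

/-- Morphisms of degree `a` differential modules. -/
structure Hom (D : GradedDM.{u, v} 𝒜 a) (E : GradedDM.{u, w} 𝒜 a) where
  toLin : D.carrier →ₗ[S] E.carrier
  map_mem : ∀ (n : ℤ) (x : D.carrier), x ∈ D.gr n → toLin x ∈ E.gr n
  comm : ∀ x : D.carrier, toLin (D.d x) = E.d (toLin x)

/-- The map on cycles induced by a morphism. -/
def Hom.cyclesMap {D : GradedDM.{u, v} 𝒜 a} {E : GradedDM.{u, w} 𝒜 a} (φ : D.Hom E) :
    LinearMap.ker D.d →ₗ[S] LinearMap.ker E.d :=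
  φ.toLin.restrict fun x hx => by
    rw [LinearMap.mem_ker] at hx ⊢
    rw [← φ.comm, hx, map_zero]

/-- The map on homology induced by a morphism. -/
def Hom.homologyMap {D : GradedDM.{u, v} 𝒜 a} {E : GradedDM.{u, w} 𝒜 a} (φ : D.Hom E) :
    D.Homology →ₗ[S] E.Homology :=
  Submodule.mapQ _ _ φ.cyclesMap (by
    rintro ⟨x, hx⟩ ⟨y, hy⟩
    exact ⟨φ.toLin y, (φ.comm y).symm.trans (congrArg φ.toLin hy)⟩)

/-- A morphism is a quasi-isomorphism if it induces an isomorphism on homology. -/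
def Hom.IsQuasiIso {D : GradedDM.{u, v} 𝒜 a} {E : GradedDM.{u, w} 𝒜 a} (φ : D.Hom E) : Prop :=
  Function.Bijective φ.homologyMap

/-- Two degree `a` differential modules are isomorphic in the category of such. -/
def IsIsomorphic (D : GradedDM.{u, v} 𝒜 a) (E : GradedDM.{u, w} 𝒜 a) : Prop :=
  ∃ e : D.carrier ≃ₗ[S] E.carrier, IsGradedEquiv D.gr E.gr e ∧ ∀ x, e (D.d x) = E.d (e x)

/-- The homology of `D` is isomorphic, as a graded module, to `M` with the grading `ℳ`. -/
def HasHomology (D : GradedDM.{u, v} 𝒜 a) {M : Type w} [AddCommGroup M] [Module S M]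
    (ℳ : ℤ → AddSubgroup M) : Prop :=
  ∃ e : D.Homology ≃ₗ[S] M, IsGradedEquiv D.homologyGr ℳ e

end GradedDM

namespace GradedComplex

variable {𝒜 : ℕ → AddSubgroup S}

/-- The cycles of a complex in homological degree `i`. -/
def cycles (F : GradedComplex.{u, v} 𝒜) : ∀ i, Submodule S (F.X i)
  | 0 => ⊤
  | i + 1 => LinearMap.ker (F.d i)

/-- The homology `H_i` of a complex. -/
abbrev Homology (F : GradedComplex.{u, v} 𝒜) (i : ℕ) : Type v :=
  F.cycles i ⧸ (LinearMap.range (F.d i)).submoduleOf (F.cycles i)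

/-- A finite free complex: `F_i` is finitely generated free for all `i`, and zero for `i ≫ 0`. -/
def IsFiniteFree (F : GradedComplex.{u, v} 𝒜) : Prop :=
  (∀ i, Module.Free S (F.X i) ∧ Module.Finite S (F.X i)) ∧
    ∃ l : ℕ, ∀ i, l < i → Subsingleton (F.X i)

/-- The total homology has finite length. (Stated degreewise; this is the same for a complex
with only finitely many nonzero terms.) -/
def HasFiniteLengthHomology (F : GradedComplex.{u, v} 𝒜) : Prop :=
  ∀ i, IsFiniteLength S (F.Homology i)

/-- Two homogeneous complexes are isomorphic (by isomorphisms of internal degree `0`). -/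
def IsIsomorphic (F : GradedComplex.{u, v} 𝒜) (G : GradedComplex.{u, w} 𝒜) : Prop :=
  ∃ e : ∀ i, F.X i ≃ₗ[S] G.X i, (∀ i, IsGradedEquiv (F.gr i) (G.gr i) (e i)) ∧
    ∀ i x, e i (F.d i x) = G.d i (e (i + 1) x)

/-- The differential of the fold, `∂ : ⨁ F_i → ⨁ F_i`. -/
def foldD (F : GradedComplex.{u, v} 𝒜) : (⨁ i, F.X i) →ₗ[S] ⨁ i, F.X i :=
  DirectSum.toModule S ℕ _ fun
    | 0 => 0
    | i + 1 => DirectSum.lof S ℕ F.X i ∘ₗ F.d i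

theorem foldD_apply (F : GradedComplex.{u, v} 𝒜) (x : ⨁ i, F.X i) (i : ℕ) :
    F.foldD x i = F.d i (x (i + 1)) := by
  induction x using DirectSum.induction_on with
  | zero => simp
  | of j x =>
    rw [foldD, ← DirectSum.lof_eq_of S, DirectSum.toModule_lof]
    cases j with
    | zero =>
      rw [DirectSum.lof_eq_of, DirectSum.of_eq_of_ne _ _ _ (Nat.succ_ne_zero i), map_zero]
      rfl
    | succ j =>
      by_cases h : j = i
      · subst h
        simp only [LinearMap.comp_apply, DirectSum.lof_apply]
      · simp only [LinearMap.comp_apply, DirectSum.lof_eq_of]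
        rw [DirectSum.of_eq_of_ne _ _ _ (Ne.symm h),
          DirectSum.of_eq_of_ne _ _ _ (fun hc => h (by omega)), map_zero]
  | add x y hx hy => rw [map_add, DirectSum.add_apply, hx, hy, DirectSum.add_apply, map_add]

/-- The degree `a` fold of a complex: the graded module `⨁ i, F_i(ia)` with differential `∂`. -/
def fold (F : GradedComplex.{u, v} 𝒜) (a : ℤ) : GradedDM.{u, v} 𝒜 a where
  carrier := ⨁ i, F.X i
  gr := sumGrading fun i => twist (F.gr i) (i * a)
  isGraded := IsGradedModule.sum fun i => (F.isGraded i).twist _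
  d := F.foldD
  d_comp_d := by
    refine LinearMap.ext fun x => DFinsupp.ext fun i => ?_
    change F.foldD (F.foldD x) i = 0
    rw [foldD_apply, foldD_apply]
    exact LinearMap.congr_fun (F.d_comp_d i) _
  d_mem := by
    intro n x hx i
    rw [foldD_apply]
    have h := F.d_mem i _ _ (hx (i + 1))
    rw [show n + ((i + 1 : ℕ) : ℤ) * a = n + a + (i : ℤ) * a by push_cast; ring] at h
    exact h

end GradedComplex

/-- A degree `a` free flag: free graded modules `F_i`, `i ≥ 0`, with a differential of degree `a`
on `⨁ i, F_i` such that `d (F_j) ⊆ ⨁ i < j, F_i`. -/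
structure FreeFlag (𝒜 : ℕ → AddSubgroup S) (a : ℤ) where
  X : ℕ → Type v
  [addCommGroup : ∀ i, AddCommGroup (X i)]
  [module : ∀ i, Module S (X i)]
  free : ∀ i, Module.Free S (X i)
  gr : ∀ i, ℤ → AddSubgroup (X i)
  isGraded : ∀ i, IsGradedModule 𝒜 (gr i)
  d : (⨁ i, X i) →ₗ[S] ⨁ i, X i
  d_comp_d : d ∘ₗ d = 0
  d_mem : ∀ (n : ℤ) (x : ⨁ i, X i), x ∈ sumGrading gr n → d x ∈ sumGrading gr (n + a)
  d_flag : ∀ (j : ℕ) (x : X j) (i : ℕ), j ≤ i → d (DirectSum.lof S ℕ X j x) i = 0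

attribute [instance] FreeFlag.addCommGroup FreeFlag.module

namespace FreeFlag

variable {𝒜 : ℕ → AddSubgroup S} {a : ℤ}

/-- The differential module underlying a free flag. -/
def toGradedDM (D : FreeFlag.{u, v} 𝒜 a) : GradedDM.{u, v} 𝒜 a where
  carrier := ⨁ i, D.X i
  gr := sumGrading D.gr
  isGraded := IsGradedModule.sum D.isGraded
  d := D.d
  d_comp_d := D.d_comp_d
  d_mem := D.d_mem

/-- The block `F_{i+1} → F_i` of the differential of a free flag. -/
def anchorD (D : FreeFlag.{u, v} 𝒜 a) (i : ℕ) : D.X (i + 1) →ₗ[S] D.X i :=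
  DirectSum.component S ℕ D.X i ∘ₗ D.d ∘ₗ DirectSum.lof S ℕ D.X (i + 1)

theorem d_apply_of_top (D : FreeFlag.{u, v} 𝒜 a) (i : ℕ) (x : ⨁ i, D.X i)
    (hx : ∀ j, i + 1 < j → x j = 0) : D.d x i = D.anchorD i (x (i + 1)) := by
  classical
  have hd : ∀ y : ⨁ i, D.X i, D.d y i = DirectSum.component S ℕ D.X i (D.d y) := fun _ => rfl
  conv_lhs => rw [← DirectSum.sum_support_of x]
  rw [hd, map_sum, map_sum]
  rw [Finset.sum_eq_single (i + 1)]
  · rfl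
  · intro j _ hj
    rcases lt_or_gt_of_ne hj with h | h
    · exact D.d_flag j (x j) i (by omega)
    · rw [hx j h, map_zero, map_zero, map_zero]
  · intro h
    rw [DFinsupp.notMem_support_iff.mp h, map_zero, map_zero, map_zero]

/-- The anchor of a free flag: the complex `F_0 ← F_1 ← F_2 ← ⋯` formed by the first off-diagonal
blocks of the differential. These maps have internal degree `a`; twisting `F_i` by `-ia`
makes them homogeneous of degree `0`. -/
def anchor (D : FreeFlag.{u, v} 𝒜 a) : GradedComplex.{u, v} 𝒜 where
  X := D.X
  gr := fun i => twist (D.gr i) (-(i * a))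
  isGraded := fun i => (D.isGraded i).twist _
  d := D.anchorD
  d_comp_d := by
    intro i
    refine LinearMap.ext fun x => ?_
    have h := D.d_apply_of_top i (D.d (DirectSum.lof S ℕ D.X (i + 1 + 1) x))
      (fun j hj => D.d_flag _ x j (by omega))
    have h0 : D.d (D.d (DirectSum.lof S ℕ D.X (i + 1 + 1) x)) = 0 :=
      LinearMap.congr_fun D.d_comp_d _
    rw [h0] at h
    exact h.symm
  d_mem := by
    intro i n x hx
    have h := D.d_mem _ _ (of_mem_sumGrading (g := D.gr) hx) i
    rw [show n + -(((i + 1 : ℕ) : ℤ) * a) + a = n + -((i : ℤ) * a) by push_cast; ring] at h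
    exact h

/-- `D` is anchored on the homogeneous complex `F`. -/
def IsAnchoredOn (D : FreeFlag.{u, v} 𝒜 a) (F : GradedComplex.{u, w} 𝒜) : Prop :=
  D.anchor.IsIsomorphic F

end FreeFlag

namespace GradedComplex

variable {𝒜 : ℕ → AddSubgroup S}

/-- `F` is `a`-rigid: every degree `a` free flag anchored on `F` is isomorphic, as a degree `a`
differential module, to the degree `a` fold of `F`. -/
def IsRigid (F : GradedComplex.{u, v} 𝒜) (a : ℤ) : Prop :=
  ∀ D : FreeFlag.{u, v} 𝒜 a, D.IsAnchoredOn F → D.toGradedDM.IsIsomorphic (F.fold a)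

end GradedComplex

/-- For a graded ring with local degree `0` part, the ideal generated by the maximal ideal of the
degree `0` part and all homogeneous elements of positive degree. -/
def homogeneousMaximalIdeal (𝒜 : ℕ → AddSubgroup S) [GradedRing 𝒜] [IsLocalRing (𝒜 0)] : Ideal S :=
  (IsLocalRing.maximalIdeal (𝒜 0)).map (algebraMap (𝒜 0) S) ⊔
    (HomogeneousIdeal.irrelevant 𝒜).toIdeal

/-- `F` with the augmentation `ε : F_0 → M` is a minimal graded free resolution of the graded
module `M`: each `F_i` is finitely generated free, `⋯ → F_1 → F_0 → M → 0` is exact, `ε` is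
homogeneous of degree `0`, and the differentials vanish modulo the homogeneous maximal ideal. -/
structure IsMinimalFreeResolution {𝒜 : ℕ → AddSubgroup S} [GradedRing 𝒜] [IsLocalRing (𝒜 0)]
    (F : GradedComplex.{u, v} 𝒜) {M : Type w} [AddCommGroup M] [Module S M]
    (ℳ : ℤ → AddSubgroup M) (ε : F.X 0 →ₗ[S] M) : Prop where
  free : ∀ i, Module.Free S (F.X i)
  finite : ∀ i, Module.Finite S (F.X i)
  exact : ∀ i, Function.Exact (F.d (i + 1)) (F.d i)
  exact_zero : Function.Exact (F.d 0) ε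
  surjective : Function.Surjective ε
  aug_mem : ∀ (n : ℤ) (x : F.X 0), x ∈ F.gr 0 n → ε x ∈ ℳ n
  minimal : ∀ i, LinearMap.range (F.d i) ≤
    homogeneousMaximalIdeal 𝒜 • (⊤ : Submodule S (F.X i))

end GradedDiff

end

noncomputable section

namespace GradedDiff

/-! ### Homogeneous components and projections of graded modules -/

variable {S : Type u} [CommRing S] {𝒜 : ℕ → AddSubgroup S}
  {M : Type v} [AddCommGroup M] [Module S M] {ℳ : ℤ → AddSubgroup M}
  {N : Type w} [AddCommGroup N] [Module S N] {𝒩 : ℤ → AddSubgroup N}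

/-! Both statements are proved by obstruction theory: a map out of the fold is built one homological
degree at a time, and each obstruction sits in an internal degree that is shifted by a nonzero
multiple of `a`. When `|a|` is large this degree lies outside the range where the relevant homology
lives.

Rigidity (`FreeFlag.isIsomorphic_fold`). Suppose the generators of all `F_i` have degrees in `[-B,
B]`, and cycles of `F` in degrees of absolute value at least `B'` are boundaries. For a flag `D`
anchored on `F`, one constructs maps `φ_i : F_i → D` with `d φ_{i+1} = φ_i ∂` whose leading
component is the given isomorphism onto the `i`-th piece of `D`. The error made by the leading term
of `φ_{i+1}` alone is a cycle supported in the pieces `j < i`. On a generator of degree `p`, its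
`j`-th component corresponds to degree `p - (i-j)a` of `F_j`. For `|a| ≥ B + B'` the anchor is
acyclic there, so the error can be removed from the top piece downwards
(`FreeFlag.exists_bounding`). The resulting map is triangular with bijective diagonal, hence an
isomorphism.

Quasi-isomorphisms (`GradedComplex.exists_isQuasiIso`). Lift the augmentation to cycles of `D` and
continue along the resolution. The first obstruction vanishes because `ε ∂ = 0`. The later ones are
classes in `H(D) ≅ M` of degree `p - (i+1)a`, with `p` the degree of a generator of `F_{i+2}`. A
minimal resolution may be infinite, so this needs the generator degrees to grow at most linearly in
`i` (`IsMinimalFreeResolution.span_eq_top`).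

Linear growth comes from a Koszul complex `K` on generators of the ideal `S_{>0}S`. Positive degree
elements act null-homotopically on it, so `M ⊗ K` and `S ⊗ K` have homology bounded above in
internal degree. Such a bound on a syzygy bounds its generators, and passing to the next syzygy
raises it by at most a constant `E` depending only on `S` and `K`. -/

/-- Extending a family of additive maps on the homogeneous components to the whole module. -/
def IsGradedModule.extend (h : IsGradedModule 𝒜 ℳ) {A : Type*} [AddCommGroup A]
    (f : ∀ n, ℳ n →+ A) : M →+ A :=
  (DirectSum.toAddMonoid f).comp
    (AddEquiv.ofBijective (DirectSum.coeAddMonoidHom ℳ) h.isInternal).symm.toAddMonoidHom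

theorem IsGradedModule.extend_of_mem (h : IsGradedModule 𝒜 ℳ) {A : Type*} [AddCommGroup A]
    (f : ∀ n, ℳ n →+ A) {n : ℤ} {x : M} (hx : x ∈ ℳ n) : h.extend f x = f n ⟨x, hx⟩ := by
  have : (AddEquiv.ofBijective (DirectSum.coeAddMonoidHom ℳ) h.isInternal).symm x =
      DirectSum.of (fun n => ℳ n) n ⟨x, hx⟩ := by
    rw [AddEquiv.symm_apply_eq]
    exact (DirectSum.coeAddMonoidHom_of ℳ n ⟨x, hx⟩).symm
  change DirectSum.toAddMonoid f
    ((AddEquiv.ofBijective (DirectSum.coeAddMonoidHom ℳ) h.isInternal).symm x) = _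
  rw [this, DirectSum.toAddMonoid_of]

theorem IsGradedModule.induction (h : IsGradedModule 𝒜 ℳ) {p : M → Prop} (x : M)
    (zero : p 0) (hom : ∀ n x, x ∈ ℳ n → p x) (add : ∀ x y, p x → p y → p (x + y)) : p x := by
  obtain ⟨y, rfl⟩ := h.isInternal.2 x
  induction y using DirectSum.induction_on with
  | zero => simpa using zero
  | of n x =>
    rw [DirectSum.coeAddMonoidHom_of]
    exact hom n _ x.2
  | add x y hx hy =>
    rw [map_add]
    exact add _ _ hx hy

/-- The projection to the homogeneous component of degree `n`. -/
def IsGradedModule.proj (h : IsGradedModule 𝒜 ℳ) (n : ℤ) : M →+ M :=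
  h.extend fun m => if m = n then (ℳ m).subtype else 0

theorem IsGradedModule.proj_of_mem (h : IsGradedModule 𝒜 ℳ) {n : ℤ} {x : M} (hx : x ∈ ℳ n) :
    h.proj n x = x := by
  rw [IsGradedModule.proj, h.extend_of_mem _ hx, if_pos rfl]
  rfl

theorem IsGradedModule.proj_of_ne (h : IsGradedModule 𝒜 ℳ) {m n : ℤ} {x : M} (hx : x ∈ ℳ m)
    (hmn : m ≠ n) : h.proj n x = 0 := by
  rw [IsGradedModule.proj, h.extend_of_mem _ hx, if_neg hmn]
  rfl

theorem IsGradedModule.proj_mem (h : IsGradedModule 𝒜 ℳ) (n : ℤ) (x : M) : h.proj n x ∈ ℳ n := by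
  induction x using h.induction with
  | zero => rw [map_zero]; exact zero_mem _
  | hom m x hx =>
    by_cases hmn : m = n
    · subst hmn
      rwa [h.proj_of_mem hx]
    · rw [h.proj_of_ne hx hmn]
      exact zero_mem _
  | add x y hx hy => rw [map_add]; exact add_mem hx hy

theorem IsGradedModule.proj_smul (h : IsGradedModule 𝒜 ℳ) {k : ℕ} {s : S} (hs : s ∈ 𝒜 k)
    (n : ℤ) (x : M) : h.proj n (s • x) = s • h.proj (n - k) x := by
  induction x using h.induction with
  | zero => simp
  | hom m x hx =>
    have hsx := h.smul_mem k m s x hs hx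
    by_cases hmn : m = n - k
    · subst hmn
      rw [sub_add_cancel] at hsx
      rw [h.proj_of_mem hsx, h.proj_of_mem hx]
    · rw [h.proj_of_ne hsx (by omega), h.proj_of_ne hx hmn, smul_zero]
  | add x y hx hy => rw [smul_add, map_add, map_add, smul_add, hx, hy]

theorem IsGradedModule.proj_comm (h : IsGradedModule 𝒜 ℳ) (h' : IsGradedModule 𝒜 𝒩)
    {f : M →+ N} {r : ℤ} (hf : ∀ n x, x ∈ ℳ n → f x ∈ 𝒩 (n + r)) (n : ℤ) (x : M) :
    h'.proj (n + r) (f x) = f (h.proj n x) := by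
  induction x using h.induction with
  | zero => simp
  | hom m x hx =>
    by_cases hmn : m = n
    · subst hmn
      rw [h'.proj_of_mem (hf _ _ hx), h.proj_of_mem hx]
    · rw [h'.proj_of_ne (hf _ _ hx) (by omega), h.proj_of_ne hx hmn, map_zero]
  | add x y hx hy => rw [map_add, map_add, map_add, map_add, hx, hy]

/-- A criterion for `ℳ` to be a grading, in terms of projections. -/
theorem isGradedModule_of_proj (pr : ℤ → M →+ M) (h1 : ∀ n x, x ∈ ℳ n → pr n x = x)
    (h2 : ∀ m n x, x ∈ ℳ m → m ≠ n → pr n x = 0) (h3 : ∀ x, x ∈ ⨆ n, ℳ n)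
    (h4 : ∀ (i : ℕ) (n : ℤ) (s : S) (x : M), s ∈ 𝒜 i → x ∈ ℳ n → s • x ∈ ℳ (n + i)) :
    IsGradedModule 𝒜 ℳ := by
  refine ⟨⟨?_, fun x => ?_⟩, h4⟩
  -- The projections recover every coordinate of `z` from its sum, which gives injectivity.
  · have key : ∀ (z : ⨁ n, ℳ n) (n : ℤ), pr n (DirectSum.coeAddMonoidHom ℳ z) = z n := by
      intro z n
      induction z using DirectSum.induction_on with
      | zero => simp
      | of m x =>
        rw [DirectSum.coeAddMonoidHom_of]
        by_cases hmn : m = n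
        · subst hmn
          rw [h1 _ _ x.2, DirectSum.of_eq_same]
        · rw [h2 _ _ _ x.2 hmn, DirectSum.of_eq_of_ne _ _ _ (Ne.symm hmn)]
          rfl
      | add x y hx hy => rw [map_add, map_add, hx, hy]; rfl
    intro y z hyz
    exact DFinsupp.ext fun n => Subtype.ext (by rw [← key, hyz, key])
  · induction h3 x using AddSubgroup.iSup_induction' with
    | hp n x hx => exact ⟨DirectSum.of _ n ⟨x, hx⟩, DirectSum.coeAddMonoidHom_of ℳ n ⟨x, hx⟩⟩
    | h1 => exact ⟨0, map_zero _⟩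
    | hadd x y _ _ hx hy =>
      obtain ⟨x', rfl⟩ := hx
      obtain ⟨y', rfl⟩ := hy
      exact ⟨x' + y', map_add _ _ _⟩

/-- An element lies in every homogeneous submodule that contains its components. -/
theorem IsGradedModule.mem_of_proj_mem (h : IsGradedModule 𝒜 ℳ) (V : AddSubgroup M) {x : M}
    (hx : ∀ n, h.proj n x ∈ V) : x ∈ V := by
  classical
  -- Asking for the formula on every larger index set makes the claim stable under addition.
  have : ∃ s : Finset ℤ, ∀ t, s ⊆ t → x = ∑ n ∈ t, h.proj n x := by
    clear hx
    induction x using h.induction with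
    | zero => exact ⟨∅, fun t _ => by simp⟩
    | hom m x hx =>
      refine ⟨{m}, fun t ht => ?_⟩
      rw [Finset.sum_eq_single m, h.proj_of_mem hx]
      · exact fun n _ hn => h.proj_of_ne hx (Ne.symm hn)
      · exact fun hm => absurd (ht (Finset.mem_singleton_self m)) hm
    | add x y hx hy =>
      obtain ⟨s, hs⟩ := hx
      obtain ⟨s', hs'⟩ := hy
      refine ⟨s ∪ s', fun t ht => ?_⟩
      simp_rw [map_add, Finset.sum_add_distrib]
      rw [← hs t (Finset.union_subset_left ht), ← hs' t (Finset.union_subset_right ht)]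
  obtain ⟨s, hs⟩ := this
  rw [hs s subset_rfl]
  exact sum_mem fun n _ => hx n

/-- A homogeneous submodule is graded. -/
theorem IsGradedModule.submodule (h : IsGradedModule 𝒜 ℳ) (V : Submodule S M)
    (hV : ∀ n x, x ∈ V → h.proj n x ∈ V) :
    IsGradedModule 𝒜 (fun n => (ℳ n).comap V.subtype.toAddMonoidHom) := by
  refine isGradedModule_of_proj
    (fun n => ((h.proj n).comp V.subtype.toAddMonoidHom).codRestrict V fun x => hV n _ x.2)
    (fun n x hx => Subtype.ext (h.proj_of_mem hx))
    (fun m n x hx hmn => Subtype.ext (h.proj_of_ne hx hmn)) (fun x => ?_)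
    (fun i n s x hs hx => h.smul_mem i n s x hs hx)
  have : (x : M) ∈ (⨆ n, (ℳ n).comap V.subtype.toAddMonoidHom).map V.subtype.toAddMonoidHom := by
    refine h.mem_of_proj_mem _ fun n => ⟨⟨h.proj n x, hV n _ x.2⟩, ?_, rfl⟩
    exact AddSubgroup.mem_iSup_of_mem n (h.proj_mem n x)
  obtain ⟨y, hy, hyx⟩ := this
  rwa [← (Subtype.ext hyx : y = x)]

/-- A weighted finite power of a graded module is graded. -/
theorem IsGradedModule.pi (h : IsGradedModule 𝒜 ℳ) {ι : Type*} [Finite ι] (wt : ι → ℕ) :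
    IsGradedModule 𝒜 (fun n => AddSubgroup.pi Set.univ fun i : ι => ℳ (n - wt i)) := by
  classical
  have := Fintype.ofFinite ι
  refine isGradedModule_of_proj
    (fun n => AddMonoidHom.pi fun i : ι => (h.proj (n - wt i)).comp (Pi.evalAddMonoidHom _ i))
    (fun n x hx => funext fun i => h.proj_of_mem (hx i trivial))
    (fun m n x hx hmn => funext fun i => h.proj_of_ne (hx i trivial) (by omega)) (fun x => ?_)
    (fun i n s x hs hx j _ => ?_)
  · rw [← Finset.univ_sum_single x]
    refine sum_mem fun i _ => ?_
    generalize x i = y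
    induction y using h.induction with
    | zero => rw [Pi.single_zero]; exact zero_mem _
    | hom m y hy =>
      refine AddSubgroup.mem_iSup_of_mem (m + wt i) fun j _ => ?_
      by_cases hij : j = i
      · subst hij
        simpa using hy
      · simp only [Pi.single_eq_of_ne hij]
        exact AddSubgroup.zero_mem _
    | add y z hy hz => rw [Pi.single_add]; exact add_mem hy hz
  · have := h.smul_mem i _ s _ hs (hx j trivial)
    rwa [show n - wt j + i = n + i - wt j by ring] at this

/-- The `ℤ`-grading of an `ℕ`-graded ring. -/
def ringGr (𝒜 : ℕ → AddSubgroup S) : ℤ → AddSubgroup S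
  | Int.ofNat n => 𝒜 n
  | Int.negSucc _ => ⊥

theorem mem_ringGr {n : ℤ} {s : S} (hs : s ∈ ringGr 𝒜 n) :
    s = 0 ∨ ∃ k : ℕ, n = k ∧ s ∈ 𝒜 k := by
  cases n with
  | ofNat k => exact Or.inr ⟨k, rfl, hs⟩
  | negSucc k => exact Or.inl hs

/-- Lets `S` be treated as one of the graded modules; its Koszul bound is the constant `E` governing
the growth of resolutions. -/
theorem isGradedModule_ringGr [GradedRing 𝒜] : IsGradedModule 𝒜 (ringGr 𝒜) := by
  refine isGradedModule_of_proj
    (fun n => if 0 ≤ n then GradedRing.proj 𝒜 n.toNat else 0) (fun n x hx => ?_)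
    (fun m n x hx hmn => ?_) (fun x => ?_) (fun i n s x hs hx => ?_)
  · obtain rfl | ⟨k, rfl, hk⟩ := mem_ringGr hx
    · exact map_zero _
    · simp [GradedRing.proj_apply, DirectSum.decompose_of_mem_same 𝒜 hk]
  · obtain rfl | ⟨k, rfl, hk⟩ := mem_ringGr hx
    · exact map_zero _
    · split_ifs with hn
      · rw [GradedRing.proj_apply, DirectSum.decompose_of_mem_ne 𝒜 hk (by omega)]
      · rfl
  · induction x using DirectSum.Decomposition.inductionOn 𝒜 with
    | zero => exact zero_mem _
    | homogeneous x => exact AddSubgroup.mem_iSup_of_mem (Int.ofNat _) x.2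
    | add x y hx hy => exact add_mem hx hy
  · obtain rfl | ⟨k, rfl, hk⟩ := mem_ringGr hx
    · rw [smul_zero]; exact zero_mem _
    · rw [add_comm (k : ℤ)]
      have : s * x ∈ 𝒜 (i + k) := SetLike.mul_mem_graded hs hk
      exact this

/-- The degree `n` component of an arbitrary preimage is again a preimage, because `f` commutes with
projections up to the shift `r`. -/
theorem IsGradedModule.exists_homogeneous_preimage (h : IsGradedModule 𝒜 ℳ)
    (h' : IsGradedModule 𝒜 𝒩) {f : M →ₗ[S] N} {r : ℤ} (hf : ∀ n x, x ∈ ℳ n → f x ∈ 𝒩 (n + r))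
    {n : ℤ} {y : N} (hy : y ∈ LinearMap.range f) (hyn : y ∈ 𝒩 (n + r)) :
    ∃ x ∈ ℳ n, f x = y := by
  obtain ⟨x, rfl⟩ := hy
  refine ⟨h.proj n x, h.proj_mem n x, ?_⟩
  exact (h.proj_comm h' (f := f.toAddMonoidHom) hf n x).symm.trans (h'.proj_of_mem hyn)

/-- Each of finitely many generators is a finite sum of homogeneous elements, so only finitely many
degrees are involved. -/
theorem IsGradedModule.exists_bound_generators (h : IsGradedModule 𝒜 ℳ) [Module.Finite S M] :
    ∃ B : ℕ, Submodule.span S {x | ∃ n : ℤ, |n| ≤ B ∧ x ∈ ℳ n} = ⊤ := by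
  have hmono : ∀ B C : ℕ, B ≤ C → Submodule.span S {x | ∃ n : ℤ, |n| ≤ B ∧ x ∈ ℳ n} ≤
      Submodule.span S {x | ∃ n : ℤ, |n| ≤ C ∧ x ∈ ℳ n} := by
    intro B C hBC
    refine Submodule.span_mono ?_
    rintro x ⟨n, hn, hx⟩
    exact ⟨n, by omega, hx⟩
  have hx : ∀ x : M, ∃ B : ℕ, x ∈ Submodule.span S {x | ∃ n : ℤ, |n| ≤ B ∧ x ∈ ℳ n} := by
    intro x
    induction x using h.induction with
    | zero => exact ⟨0, zero_mem _⟩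
    | hom n x hx => exact ⟨n.natAbs, Submodule.subset_span ⟨n, by simp, hx⟩⟩
    | add x y hx hy =>
      obtain ⟨B, hB⟩ := hx
      obtain ⟨C, hC⟩ := hy
      exact ⟨max B C, add_mem (hmono _ _ (le_max_left _ _) hB) (hmono _ _ (le_max_right _ _) hC)⟩
  obtain ⟨s, hs⟩ := (Module.Finite.fg_top : (⊤ : Submodule S M).FG)
  choose B hB using hx
  refine ⟨s.sup B, ?_⟩
  rw [eq_top_iff, ← hs, Submodule.span_le]
  exact fun x hx => hmono _ _ (Finset.le_sup hx) (hB x)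

/-! ### Homogeneous lifting, Artinian degree bounds and graded Nakayama -/

section GradedRing

variable [GradedRing 𝒜]

/-- The homogeneous component of degree `r` of a linear map. -/
def homComp (h : IsGradedModule 𝒜 ℳ) (h' : IsGradedModule 𝒜 𝒩) (f : M →ₗ[S] N) (r : ℤ) :
    M →ₗ[S] N where
  toFun := h.extend fun n => (h'.proj (n + r)).comp (f.toAddMonoidHom.comp (ℳ n).subtype)
  map_add' := map_add _
  map_smul' s x := by
    simp only [RingHom.id_apply]
    induction x using h.induction with
    | zero => simp
    | hom n x hx =>
      induction s using DirectSum.Decomposition.inductionOn 𝒜 with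
      | zero => simp
      | @homogeneous k s =>
        rw [h.extend_of_mem _ hx, h.extend_of_mem _ (h.smul_mem k n s x s.2 hx)]
        change h'.proj (n + k + r) (f ((s : S) • x)) = (s : S) • h'.proj (n + r) (f x)
        rw [map_smul, h'.proj_smul s.2]
        congr 2
        rw [show n + k + r - k = n + r by ring]
      | add s t hs ht => rw [add_smul, map_add, hs, ht, add_smul]
    | add x y hx hy => rw [smul_add, map_add, map_add, hx, hy, smul_add]

theorem homComp_apply (h : IsGradedModule 𝒜 ℳ) (h' : IsGradedModule 𝒜 𝒩) (f : M →ₗ[S] N) (r : ℤ)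
    {n : ℤ} {x : M} (hx : x ∈ ℳ n) : homComp h h' f r x = h'.proj (n + r) (f x) :=
  h.extend_of_mem _ hx

theorem homComp_mem (h : IsGradedModule 𝒜 ℳ) (h' : IsGradedModule 𝒜 𝒩) (f : M →ₗ[S] N) (r : ℤ)
    {n : ℤ} {x : M} (hx : x ∈ ℳ n) : homComp h h' f r x ∈ 𝒩 (n + r) := by
  rw [homComp_apply h h' f r hx]
  exact h'.proj_mem _ _

/-- Homogeneous lifting of homogeneous maps from a projective graded module. -/
theorem exists_graded_lift (h : IsGradedModule 𝒜 ℳ) [Module.Projective S M]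
    (h' : IsGradedModule 𝒜 𝒩) {R : Type*} [AddCommGroup R] [Module S R] {ℛ : ℤ → AddSubgroup R}
    (h'' : IsGradedModule 𝒜 ℛ) (f : M →ₗ[S] R) (g : N →ₗ[S] R) (r s : ℤ)
    (hf : ∀ n x, x ∈ ℳ n → f x ∈ ℛ (n + r + s)) (hg : ∀ n x, x ∈ 𝒩 n → g x ∈ ℛ (n + s))
    (hfg : ∀ x, f x ∈ LinearMap.range g) :
    ∃ k : M →ₗ[S] N, (∀ x, g (k x) = f x) ∧ ∀ n x, x ∈ ℳ n → k x ∈ 𝒩 (n + r) := by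
  obtain ⟨k, hk⟩ := Module.projective_lifting_property g.rangeRestrict
    (f.codRestrict (LinearMap.range g) hfg) g.surjective_rangeRestrict
  have hk' : ∀ x, g (k x) = f x := fun x => congrArg Subtype.val (LinearMap.congr_fun hk x)
  -- The degree `r` part of an ungraded lift is still a lift, since `f` and `g` are homogeneous.
  refine ⟨homComp h h' k r, fun x => ?_, fun n x hx => homComp_mem h h' k r hx⟩
  induction x using h.induction with
  | zero => simp
  | hom n x hx =>
    rw [homComp_apply h h' k r hx]
    have := h'.proj_comm h'' (f := g.toAddMonoidHom) hg (n + r) (k x)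
    refine this.symm.trans ?_
    change h''.proj (n + r + s) (g (k x)) = f x
    rw [hk', h''.proj_of_mem (hf n x hx)]
  | add x y hx hy => rw [map_add, map_add, map_add, hx, hy]

/-- The submodule generated by homogeneous elements of degree at least `c` lives in degrees at
least `c`. -/
theorem IsGradedModule.proj_eq_zero_of_mem_span (h : IsGradedModule 𝒜 ℳ) {c : ℤ} {x : M}
    (hx : x ∈ Submodule.span S {x | ∃ n, c ≤ n ∧ x ∈ ℳ n}) {n : ℤ} (hn : n < c) :
    h.proj n x = 0 := by
  induction hx using Submodule.span_induction generalizing n with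
  | mem x hx =>
    obtain ⟨m, hm, hx⟩ := hx
    exact h.proj_of_ne hx (by omega)
  | zero => exact map_zero _
  | add x y _ _ hx hy => rw [map_add, hx hn, hy hn, add_zero]
  | smul s x _ hx =>
    induction s using DirectSum.Decomposition.inductionOn 𝒜 with
    | zero => simp
    | @homogeneous k s => rw [h.proj_smul s.2, hx (by omega), smul_zero]
    | add s t hs ht => rw [add_smul, map_add, hs, ht, add_zero]

theorem IsGradedModule.eq_zero_of_span_eq_top (h : IsGradedModule 𝒜 ℳ) {c : ℤ}
    (hc : Submodule.span S {x | ∃ n, c ≤ n ∧ x ∈ ℳ n} = ⊤) {n : ℤ} {x : M} (hx : x ∈ ℳ n)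
    (hn : n < c) : x = 0 := by
  rw [← h.proj_of_mem hx]
  exact h.proj_eq_zero_of_mem_span (hc ▸ Submodule.mem_top) hn

/-- A homogeneous map from a finitely generated graded module to an Artinian module kills all
components of large absolute degree. -/
theorem IsGradedModule.exists_bound_of_artinian (h : IsGradedModule 𝒜 ℳ) [Module.Finite S M]
    [IsArtinian S N] (q : M →ₗ[S] N) (hq : ∀ n x, q x = 0 → q (h.proj n x) = 0) :
    ∃ B : ℕ, ∀ (n : ℤ) (x : M), (B : ℤ) ≤ |n| → x ∈ ℳ n → q x = 0 := by
  obtain ⟨B, hB⟩ := h.exists_bound_generators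
  have hB' : Submodule.span S {x | ∃ n, -(B : ℤ) ≤ n ∧ x ∈ ℳ n} = ⊤ := by
    rw [eq_top_iff, ← hB]
    refine Submodule.span_mono ?_
    rintro x ⟨n, hn, hx⟩
    exact ⟨n, neg_le_of_abs_le hn, hx⟩
  -- The images of the submodules generated in degrees at least `k` form a descending chain, which
  -- stabilizes.
  let C : ℕ →o (Submodule S N)ᵒᵈ :=
    ⟨fun k => OrderDual.toDual
      ((Submodule.span S {x | ∃ n, (k : ℤ) ≤ n ∧ x ∈ ℳ n}).map q), fun k l hkl =>
      OrderDual.toDual_le_toDual.mpr (Submodule.map_mono (Submodule.span_mono (by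
        rintro x ⟨n, hn, hx⟩
        exact ⟨n, by omega, hx⟩)))⟩
  obtain ⟨n₀, hn₀⟩ := IsArtinian.monotone_stabilizes C
  have hC : ∀ k, n₀ ≤ k → (Submodule.span S {x | ∃ n, (k : ℤ) ≤ n ∧ x ∈ ℳ n}).map q =
      (Submodule.span S {x | ∃ n, ((k + 1 : ℕ) : ℤ) ≤ n ∧ x ∈ ℳ n}).map q := fun k hk =>
    ((hn₀ k hk).symm.trans (hn₀ (k + 1) (by omega)) : C k = C (k + 1))
  -- `B + 1` disposes of negative degrees, as generators start at `-B`; `n₀` disposes of the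
  -- positive ones.
  refine ⟨max n₀ (B + 1), fun n x hn hx => ?_⟩
  rcases lt_or_ge n 0 with hneg | hpos
  · rw [h.eq_zero_of_span_eq_top hB' hx (by rw [abs_of_neg hneg] at hn; omega), map_zero]
  · lift n to ℕ using hpos
    have hqx : q x ∈ (Submodule.span S {x | ∃ m, (n : ℤ) ≤ m ∧ x ∈ ℳ m}).map q :=
      Submodule.mem_map_of_mem (Submodule.subset_span ⟨n, le_rfl, hx⟩)
    rw [Nat.abs_cast] at hn
    rw [hC n (by omega)] at hqx
    obtain ⟨y, hy, hyx⟩ := hqx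
    -- Here `y` lives in degrees above `n`, so the degree `n` component of `x - y` is `x` itself.
    have h0 := hq n (x - y) (by rw [map_sub, hyx, sub_self])
    rwa [map_sub, h.proj_of_mem hx, h.proj_eq_zero_of_mem_span hy (by omega), sub_zero] at h0

/-- A graded version of Nakayama's lemma. -/
theorem IsGradedModule.eq_top_of_sup_smul_eq_top [IsLocalRing (𝒜 0)] (h : IsGradedModule 𝒜 ℳ)
    [Module.Finite S M] (G : Submodule S M) (hG : ∀ n x, x ∈ G → h.proj n x ∈ G)
    (hGM : G ⊔ homogeneousMaximalIdeal 𝒜 • ⊤ = ⊤) : G = ⊤ := by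
  -- The determinant trick gives `s ≡ 1` modulo the homogeneous maximal ideal with `s M ⊆ G`. Its
  -- degree `0` part is a unit of the local ring `𝒜 0`, and on degree `n` elements the degree `n`
  -- part of `s x` is `s_0 x`.
  obtain ⟨s, hs, hsM⟩ := Submodule.exists_sub_one_mem_and_smul_eq_zero_of_fg_of_le_smul
    (homogeneousMaximalIdeal 𝒜) (⊤ : Submodule S (M ⧸ G)) Module.Finite.fg_top (by
      rw [← Submodule.range_mkQ G, LinearMap.range_eq_map, ← Submodule.map_smul'', ← hGM,
        Submodule.map_sup]
      rw [sup_le_iff]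
      refine ⟨?_, ?_⟩
      · rintro _ ⟨x, hx, rfl⟩
        rw [Submodule.mkQ_apply, (Submodule.Quotient.mk_eq_zero G).mpr hx]
        exact zero_mem _
      · rw [hGM])
  have hm : homogeneousMaximalIdeal 𝒜 ≤
      (IsLocalRing.maximalIdeal (𝒜 0)).comap (GradedRing.projZeroRingHom' 𝒜) := by
    refine sup_le ?_ ?_
    · rw [Ideal.map_le_iff_le_comap]
      intro x hx
      rw [Ideal.mem_comap, Ideal.mem_comap]
      have : GradedRing.projZeroRingHom' 𝒜 (algebraMap (𝒜 0) S x) = x :=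
        GradedRing.projZeroRingHom'_apply_coe 𝒜 x
      rwa [this]
    · intro x hx
      have h0 : GradedRing.projZeroRingHom' 𝒜 x = 0 := Subtype.ext hx
      rw [Ideal.mem_comap, h0]
      exact zero_mem _
  have hunit : IsUnit (GradedRing.projZeroRingHom' 𝒜 s) := by
    by_contra hc
    have h1 := hm hs
    rw [Ideal.mem_comap, map_sub, map_one] at h1
    have h2 : GradedRing.projZeroRingHom' 𝒜 s ∈ IsLocalRing.maximalIdeal (𝒜 0) := hc
    exact (Ideal.ne_top_iff_one _).mp (IsLocalRing.maximalIdeal.isMaximal (𝒜 0)).ne_top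
      (by simpa using sub_mem h2 h1)
  obtain ⟨t, ht⟩ := hunit.exists_left_inv
  have hsx : ∀ x : M, s • x ∈ G := fun x => by
    rw [← Submodule.Quotient.mk_eq_zero, Submodule.Quotient.mk_smul]
    exact hsM _ trivial
  have hproj : ∀ (s : S) (n : ℤ) (x : M), x ∈ ℳ n →
      h.proj n (s • x) = (GradedRing.projZeroRingHom' 𝒜 s : S) • x := by
    intro s n x hx
    induction s using DirectSum.Decomposition.inductionOn 𝒜 with
    | zero => simp
    | @homogeneous k s =>
      rw [h.proj_smul s.2]
      rcases Nat.eq_zero_or_pos k with rfl | hk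
      · rw [Nat.cast_zero, sub_zero, h.proj_of_mem hx, GradedRing.projZeroRingHom'_apply_coe]
      · rw [h.proj_of_ne hx (by omega), smul_zero, GradedRing.coe_projZeroRingHom'_apply,
          GradedRing.projZeroRingHom_apply, DirectSum.decompose_of_mem_ne _ s.2 (by omega),
          zero_smul]
    | add s t hs ht => rw [add_smul, map_add, hs, ht, map_add, AddSubgroup.coe_add, add_smul]
  rw [eq_top_iff]
  intro x _
  induction x using h.induction with
  | zero => exact zero_mem _
  | hom n x hx =>
    have h1 := hG n _ (hsx x)
    rw [hproj s n x hx] at h1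
    have h2 := G.smul_mem (t : S) h1
    have h3 : (t : S) * (GradedRing.projZeroRingHom' 𝒜 s : S) = 1 := congrArg Subtype.val ht
    rwa [smul_smul, h3, one_smul] at h2
  | add x y hx hy => exact add_mem (hx trivial) (hy trivial)

end GradedRing

theorem IsGradedModule.proj_comm_zero (h : IsGradedModule 𝒜 ℳ) (h' : IsGradedModule 𝒜 𝒩)
    {f : M →ₗ[S] N} (hf : ∀ n x, x ∈ ℳ n → f x ∈ 𝒩 n) (n : ℤ) (x : M) :
    h'.proj n (f x) = f (h.proj n x) := by
  have := h.proj_comm h' (f := f.toAddMonoidHom) (r := 0)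
    (fun n x hx => by rw [add_zero]; exact hf n x hx) n x
  rwa [add_zero] at this

theorem IsGradedModule.ringGr_smul_mem (h : IsGradedModule 𝒜 ℳ) {m n : ℤ} {s : S} {x : M}
    (hs : s ∈ ringGr 𝒜 m) (hx : x ∈ ℳ n) : s • x ∈ ℳ (m + n) := by
  obtain rfl | ⟨k, rfl, hk⟩ := mem_ringGr hs
  · rw [zero_smul]
    exact zero_mem _
  · rw [add_comm]
    exact h.smul_mem k n s x hk hx

/-! ### Koszul complexes as square-zero matrices -/

section matAct

variable {ι : Type} [Fintype ι]

/-- The action of a square matrix over `S` on vectors with entries in an `S`-module. -/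
def matAct (A : Matrix ι ι S) : (ι → M) →ₗ[S] (ι → M) :=
  LinearMap.pi fun i => ∑ j, A i j • LinearMap.proj j

theorem matAct_apply (A : Matrix ι ι S) (z : ι → M) (i : ι) :
    matAct A z i = ∑ j, A i j • z j := by
  simp [matAct]

theorem matAct_mul (A B : Matrix ι ι S) (z : ι → M) :
    matAct (A * B) z = matAct A (matAct B z) := by
  ext i
  simp_rw [matAct_apply, Matrix.mul_apply, Finset.smul_sum, Finset.sum_smul, mul_smul]
  rw [Finset.sum_comm]

theorem matAct_add (A B : Matrix ι ι S) (z : ι → M) :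
    matAct (A + B) z = matAct A z + matAct B z := by
  ext i
  simp [matAct_apply, add_smul, Finset.sum_add_distrib]

theorem matAct_zero (z : ι → M) : matAct (0 : Matrix ι ι S) z = 0 := by
  ext i
  simp [matAct_apply]

theorem matAct_smul_one [DecidableEq ι] (s : S) (z : ι → M) :
    matAct (s • (1 : Matrix ι ι S)) z = s • z := by
  ext i
  simp [matAct_apply, Matrix.one_apply]

theorem matAct_map (A : Matrix ι ι S) (f : M →ₗ[S] N) (z : ι → M) :
    matAct A (fun i => f (z i)) = fun i => f (matAct A z i) := by
  ext i
  simp [matAct_apply]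

end matAct

/-- A finite free differential module over `S` given by a homogeneous square-zero matrix, with a
distinguished basis vector of weight `0`; the Koszul complexes are of this form. -/
structure KoszulMatrix (𝒜 : ℕ → AddSubgroup S) where
  ι : Type
  [fintype : Fintype ι]
  [decEq : DecidableEq ι]
  A : Matrix ι ι S
  wt : ι → ℕ
  base : ι
  sq : A * A = 0
  hom : ∀ i j, A i j = 0 ∨ ∃ k, A i j ∈ 𝒜 k ∧ wt j = wt i + k
  wt_base : wt base = 0
  -- These two conditions make the base vector a cycle and force the base coordinate of a boundary
  -- to involve only entries of positive weight: a substitute for `H_0 = V / S_{>0} V`.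
  col_base : ∀ i, A i base = 0
  row_base : ∀ j, A base j = 0 ∨ 0 < wt j

attribute [instance] KoszulMatrix.fintype KoszulMatrix.decEq

namespace KoszulMatrix

/-- Multiplication by `s` is null-homotopic. -/
def Kills (K : KoszulMatrix 𝒜) (s : S) : Prop :=
  ∃ B : Matrix K.ι K.ι S, K.A * B + B * K.A = s • 1

/-- The Koszul matrix of the empty sequence. -/
def trivial (𝒜 : ℕ → AddSubgroup S) : KoszulMatrix 𝒜 where
  ι := Unit
  A := 0
  wt _ := 0
  base := ()
  sq := zero_mul _
  hom _ _ := Or.inl rfl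
  wt_base := rfl
  col_base _ := rfl
  row_base _ := Or.inl rfl

/-- The mapping cone of multiplication by a homogeneous element of positive degree. -/
def cone (K : KoszulMatrix 𝒜) {k : ℕ} (hk : 0 < k) {x : S} (hx : x ∈ 𝒜 k) : KoszulMatrix 𝒜 where
  ι := K.ι ⊕ K.ι
  A := Matrix.fromBlocks K.A (x • 1) 0 (-K.A)
  wt := Sum.elim K.wt fun i => K.wt i + k
  base := Sum.inl K.base
  sq := by
    rw [Matrix.fromBlocks_multiply, ← Matrix.fromBlocks_zero]
    simp [K.sq]
  hom := by
    rintro (i | i) (j | j)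
    · exact K.hom i j
    · by_cases hij : i = j
      · subst hij
        exact Or.inr ⟨k, by simpa using hx, rfl⟩
      · exact Or.inl (by simp [hij])
    · exact Or.inl rfl
    · obtain h | ⟨m, hm, hw⟩ := K.hom i j
      · exact Or.inl (by simp [h])
      · exact Or.inr ⟨m, by simpa using hm, by simp [hw]; ring⟩
  wt_base := K.wt_base
  col_base := by
    rintro (i | i)
    · exact K.col_base i
    · rfl
  row_base := by
    rintro (j | j)
    · exact K.row_base j
    · exact Or.inr (by simp [hk])

/-- A homotopy `B` extends to the cone as `diag(B, -B)`; the sign cancels the two off-diagonal terms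
`xB`. -/
theorem Kills.cone {K : KoszulMatrix 𝒜} {s : S} (h : K.Kills s) {k : ℕ} (hk : 0 < k) {x : S}
    (hx : x ∈ 𝒜 k) : (K.cone hk hx).Kills s := by
  obtain ⟨B, hB⟩ := h
  have H : Matrix.fromBlocks K.A (x • 1) 0 (-K.A) * Matrix.fromBlocks B 0 0 (-B) +
      Matrix.fromBlocks B 0 0 (-B) * Matrix.fromBlocks K.A (x • 1) 0 (-K.A) =
      s • (1 : Matrix (K.ι ⊕ K.ι) (K.ι ⊕ K.ι) S) := by
    rw [Matrix.fromBlocks_multiply, Matrix.fromBlocks_multiply, Matrix.fromBlocks_add,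
      ← Matrix.fromBlocks_one, Matrix.fromBlocks_smul]
    simp [hB]
  exact ⟨Matrix.fromBlocks B 0 0 (-B), H⟩

/-- The homotopy is the identity from the first copy of `K` to the second. -/
theorem kills_cone (K : KoszulMatrix 𝒜) {k : ℕ} (hk : 0 < k) {x : S} (hx : x ∈ 𝒜 k) :
    (K.cone hk hx).Kills x := by
  have H : Matrix.fromBlocks K.A (x • 1) 0 (-K.A) * Matrix.fromBlocks 0 0 1 0 +
      Matrix.fromBlocks 0 0 1 0 * Matrix.fromBlocks K.A (x • 1) 0 (-K.A) =
      x • (1 : Matrix (K.ι ⊕ K.ι) (K.ι ⊕ K.ι) S) := by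
    rw [Matrix.fromBlocks_multiply, Matrix.fromBlocks_multiply, Matrix.fromBlocks_add,
      ← Matrix.fromBlocks_one, Matrix.fromBlocks_smul]
    simp
  exact ⟨Matrix.fromBlocks 0 0 1 0, H⟩

theorem exists_kills_list (l : List S) (hl : ∀ x ∈ l, ∃ k, 0 < k ∧ x ∈ 𝒜 k) :
    ∃ K : KoszulMatrix 𝒜, ∀ x ∈ l, K.Kills x := by
  induction l with
  | nil => exact ⟨trivial 𝒜, by simp⟩
  | cons x l ih =>
    obtain ⟨K, hK⟩ := ih fun y hy => hl y (List.mem_cons_of_mem _ hy)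
    obtain ⟨k, hk, hx⟩ := hl x List.mem_cons_self
    refine ⟨K.cone hk hx, fun y hy => ?_⟩
    obtain rfl | hy := List.mem_cons.mp hy
    · exact K.kills_cone hk hx
    · exact (hK y hy).cone hk hx

/-- Over a Noetherian graded ring there is a Koszul matrix on which all elements of positive
degree are null-homotopic. -/
theorem exists_kills [IsNoetherianRing S] (𝒜 : ℕ → AddSubgroup S) :
    ∃ K : KoszulMatrix 𝒜, ∀ k : ℕ, 0 < k → ∀ x ∈ 𝒜 k, K.Kills x := by
  obtain ⟨t, ht, hspan⟩ := (Submodule.fg_span_iff_fg_span_finset_subset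
    {x : S | ∃ k, 0 < k ∧ x ∈ 𝒜 k}).mp (IsNoetherian.noetherian (Submodule.span S {x : S | ∃ k, 0 < k ∧ x ∈ 𝒜 k}))
  obtain ⟨K, hK⟩ := exists_kills_list (𝒜 := 𝒜) t.toList (fun x hx => ht (by simpa using hx))
  refine ⟨K, fun k hk x hx => ?_⟩
  have hxt : x ∈ Submodule.span S (t : Set S) := hspan ▸ Submodule.subset_span ⟨k, hk, hx⟩
  clear hx
  -- The elements acting null-homotopically form an ideal, so checking generators suffices.
  induction hxt using Submodule.span_induction with
  | mem x hx => exact hK x (by simpa using hx)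
  | zero => exact ⟨0, by simp⟩
  | add x y _ _ hx hy =>
    obtain ⟨B, hB⟩ := hx
    obtain ⟨C, hC⟩ := hy
    exact ⟨B + C, by rw [mul_add, add_mul, add_smul, ← hB, ← hC]; abel⟩
  | smul s x _ hx =>
    obtain ⟨B, hB⟩ := hx
    exact ⟨s • B, by rw [mul_smul_comm, smul_mul_assoc, ← smul_add, hB, smul_smul, smul_eq_mul]⟩

/-! ### Koszul homology as a bound on degrees of generators -/

variable (K : KoszulMatrix 𝒜)

/-- The homology of `V ⊗ K` vanishes in degrees above `b`. -/
def BoundedOn (ℳ : ℤ → AddSubgroup M) (V : Submodule S M) (b : ℤ) : Prop :=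
  ∀ n, b < n → ∀ z : K.ι → M, (∀ i, z i ∈ V) → (∀ i, z i ∈ ℳ (n - K.wt i)) →
    matAct K.A z = 0 →
      ∃ y : K.ι → M, (∀ i, y i ∈ V) ∧ (∀ i, y i ∈ ℳ (n - K.wt i)) ∧ matAct K.A y = z

/-- The weights are chosen so that the Koszul differential has internal degree `0`; hence no degree
shift appears in the homology arguments. -/
theorem matAct_mem (h : IsGradedModule 𝒜 ℳ) {n : ℤ} {z : K.ι → M}
    (hz : ∀ i, z i ∈ ℳ (n - K.wt i)) (i : K.ι) : matAct K.A z i ∈ ℳ (n - K.wt i) := by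
  rw [matAct_apply]
  refine sum_mem fun j _ => ?_
  obtain h0 | ⟨k, hk, hw⟩ := K.hom i j
  · rw [h0, zero_smul]
    exact zero_mem _
  · have := h.smul_mem k _ _ _ hk (hz j)
    rwa [hw, show n - ((K.wt i + k : ℕ) : ℤ) + k = n - K.wt i by push_cast; ring] at this

/-- The cycles are finitely generated in degrees at most `B`. A cycle of larger degree is a
combination of them with coefficients of positive degree, and such multiples of cycles are
boundaries. -/
theorem exists_boundedOn_top [GradedRing 𝒜] [IsNoetherianRing S]
    (hK : ∀ k : ℕ, 0 < k → ∀ x ∈ 𝒜 k, K.Kills x) (h : IsGradedModule 𝒜 ℳ) [Module.Finite S M] :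
    ∃ b : ℕ, K.BoundedOn ℳ ⊤ b := by
  have hpi := h.pi K.wt
  have hhom : ∀ n z, z ∈ (AddSubgroup.pi Set.univ fun i : K.ι => ℳ (n - K.wt i)) →
      matAct K.A z ∈ (AddSubgroup.pi Set.univ fun i : K.ι => ℳ (n - K.wt i)) :=
    fun n z hz i _ => K.matAct_mem h (fun i => hz i _root_.trivial) i
  have hZ := hpi.submodule (LinearMap.ker (matAct (M := M) K.A)) (fun n x hx => by
    rw [LinearMap.mem_ker] at hx ⊢
    rw [← hpi.proj_comm_zero hpi hhom, hx, map_zero])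
  obtain ⟨B, hB⟩ := hZ.exists_bound_generators
  have hkill : ∀ k : ℕ, 0 < k → ∀ s ∈ 𝒜 k, ∀ z : LinearMap.ker (matAct (M := M) K.A),
      s • (z : K.ι → M) ∈ LinearMap.range (matAct (M := M) K.A) := by
    intro k hk s hs z
    obtain ⟨C, hC⟩ := hK k hk s hs
    refine ⟨matAct C z, ?_⟩
    rw [← matAct_smul_one, ← hC, matAct_add, matAct_mul, matAct_mul, z.2, map_zero, add_zero]
  have key : ∀ z : LinearMap.ker (matAct (M := M) K.A), ∀ n : ℤ, (B : ℤ) < n →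
      (hZ.proj n z : K.ι → M) ∈ LinearMap.range (matAct (M := M) K.A) := by
    intro z
    have hz : z ∈ (⊤ : Submodule S (LinearMap.ker (matAct (M := M) K.A))) := _root_.trivial
    rw [← hB] at hz
    induction hz using Submodule.span_induction with
    | mem z hz =>
      intro n hn
      obtain ⟨m, hm, hz⟩ := hz
      rw [hZ.proj_of_ne hz (by have := le_of_abs_le hm; omega)]
      exact zero_mem _
    | zero => intro n _; rw [map_zero]; exact zero_mem _
    | add x y _ _ hx hy => intro n hn; rw [map_add]; exact add_mem (hx n hn) (hy n hn)
    | smul s z _ hz =>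
      intro n hn
      induction s using DirectSum.Decomposition.inductionOn 𝒜 with
      | zero => rw [zero_smul, map_zero]; exact zero_mem _
      | @homogeneous k s =>
        rw [hZ.proj_smul s.2]
        rcases Nat.eq_zero_or_pos k with rfl | hk
        · exact Submodule.smul_mem _ _ (hz _ (by simpa using hn))
        · exact hkill k hk s s.2 _
      | add s t hs ht => rw [add_smul, map_add]; exact add_mem hs ht
  refine ⟨B, fun n hn z _ hz hAz => ?_⟩
  have hzn : (⟨z, hAz⟩ : LinearMap.ker (matAct (M := M) K.A)) ∈
      (AddSubgroup.pi Set.univ fun i : K.ι => ℳ (n - K.wt i)).comap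
        (LinearMap.ker (matAct (M := M) K.A)).subtype.toAddMonoidHom := fun i _ => hz i
  have hr := key ⟨z, hAz⟩ n hn
  rw [hZ.proj_of_mem hzn] at hr
  obtain ⟨y, hy⟩ := hr
  refine ⟨hpi.proj n y, fun _ => _root_.trivial, fun i => hpi.proj_mem n y i _root_.trivial, ?_⟩
  rw [← hpi.proj_comm_zero hpi hhom, hy]
  exact hpi.proj_of_mem fun i _ => hz i

/-- A projective graded module with generators in degrees at most `b` satisfies the bound
of `S`, shifted by `b`. -/
theorem boundedOn_of_projective [GradedRing 𝒜] (h : IsGradedModule 𝒜 ℳ) [Module.Projective S M]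
    [Module.Finite S M] {b E : ℤ} (hE : K.BoundedOn (ringGr 𝒜) ⊤ E)
    (hb : Submodule.span S {x | ∃ n, n ≤ b ∧ x ∈ ℳ n} = ⊤) : K.BoundedOn ℳ ⊤ (b + E) := by
  classical
  obtain ⟨T, hT, hspan⟩ := (Submodule.fg_span_iff_fg_span_finset_subset
    {x | ∃ n, n ≤ b ∧ x ∈ ℳ n}).mp (hb ▸ Module.Finite.fg_top)
  choose p hpb hp using fun t : T => hT t.2
  have hS := isGradedModule_ringGr (𝒜 := 𝒜)
  -- Splitting the cover by generators and keeping the components `τ t` of the right degree exhibits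
  -- the module as a graded summand of a sum of twists of `S`; each summand contributes the bound
  -- `E` shifted by `p t ≤ b`.
  obtain ⟨σ, hσ⟩ := Module.projective_lifting_property
    (Fintype.linearCombination S (Subtype.val : T → M)) LinearMap.id (by
      rw [← LinearMap.range_eq_top, Fintype.range_linearCombination, Subtype.range_coe_subtype]
      exact hspan.symm.trans hb)
  have hσ' : ∀ x, ∑ t : T, σ x t • (t : M) = x := fun x => LinearMap.congr_fun hσ x
  let τ : T → M →ₗ[S] S := fun t => homComp h hS (LinearMap.proj t ∘ₗ σ) (-p t)
  have hτmem : ∀ t n x, x ∈ ℳ n → τ t x ∈ ringGr 𝒜 (n + -p t) :=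
    fun t n x hx => homComp_mem h hS _ _ hx
  have hτ : ∀ x, ∑ t : T, τ t x • (t : M) = x := by
    intro x
    induction x using h.induction with
    | zero => simp
    | hom n x hx =>
      have h1 := congrArg (h.proj n) (hσ' x)
      rw [map_sum, h.proj_of_mem hx] at h1
      refine Eq.trans (Finset.sum_congr rfl fun t _ => ?_) h1
      have h2 := hS.proj_comm h (f := (LinearMap.toSpanSingleton S M t).toAddMonoidHom) (r := p t)
        (fun n s hs => h.ringGr_smul_mem hs (hp t)) (n + -p t) (σ x t)
      rw [neg_add_cancel_right] at h2
      have h3 : τ t x = hS.proj (n + -p t) (σ x t) := homComp_apply h hS _ _ hx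
      rw [h3]
      exact h2.symm
    | add x y hx hy =>
      simp_rw [map_add, add_smul, Finset.sum_add_distrib]
      rw [hx, hy]
  intro n hn z _ hz hAz
  have hy : ∀ t : T, ∃ y : K.ι → S, (∀ i, y i ∈ ringGr 𝒜 (n - p t - K.wt i)) ∧
      matAct K.A y = fun i => τ t (z i) := by
    intro t
    obtain ⟨y, -, hy, hAy⟩ := hE (n - p t) (by have := hpb t; omega) (fun i => τ t (z i))
      (fun _ => _root_.trivial) (fun i => by
        have := hτmem t _ _ (hz i)
        rwa [show n - K.wt i + -p t = n - p t - K.wt i by ring] at this)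
      (by rw [matAct_map, hAz]; ext i; simp)
    exact ⟨y, hy, hAy⟩
  choose y hy hAy using hy
  refine ⟨fun i => ∑ t : T, y t i • (t : M), fun _ => _root_.trivial,
    fun i => sum_mem fun t _ => ?_, ?_⟩
  · have := h.ringGr_smul_mem (hy t i) (hp t)
    rwa [show n - p t - K.wt i + p t = n - K.wt i by ring] at this
  · ext i
    rw [matAct_apply]
    conv_rhs => rw [← hτ (z i)]
    simp_rw [Finset.smul_sum]
    rw [Finset.sum_comm]
    refine Finset.sum_congr rfl fun t _ => ?_
    rw [← congrFun (hAy t) i, matAct_apply, Finset.sum_smul]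
    simp_rw [smul_assoc]

/-- The bound for the kernel in terms of the bounds for the source and the image. -/
theorem boundedOn_ker (h : IsGradedModule 𝒜 ℳ) (h' : IsGradedModule 𝒜 𝒩)
    {f : M →ₗ[S] N} (hf : ∀ n x, x ∈ ℳ n → f x ∈ 𝒩 n) {b c : ℤ} (hbc : b ≤ c)
    (hM : K.BoundedOn ℳ ⊤ c) (hN : K.BoundedOn 𝒩 (LinearMap.range f) b) :
    K.BoundedOn ℳ (LinearMap.ker f) c := by
  intro n hn z hzV hz hAz
  obtain ⟨y, -, hy, hAy⟩ := hM n hn z (fun _ => _root_.trivial) hz hAz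
  obtain ⟨x, hxV, hx, hAx⟩ := hN n (by omega) (fun i => f (y i)) (fun i => ⟨_, rfl⟩)
    (fun i => hf _ _ (hy i)) (by rw [matAct_map, hAy]; ext i; exact hzV i)
  have hlift : ∀ i, ∃ x' ∈ ℳ (n - K.wt i), f x' = x i := fun i =>
    h.exists_homogeneous_preimage h' (r := 0) (fun n x hx => by rw [add_zero]; exact hf n x hx)
      (hxV i) (by rw [add_zero]; exact hx i)
  choose x' hx' hfx' using hlift
  -- The connecting-map chase: `f y` is a cycle in the image, hence the boundary of `f x'`, so this
  -- correction of `y` lies in the kernel and still bounds `z`.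
  refine ⟨y - matAct K.A x', fun i => ?_, fun i => sub_mem (hy i) (K.matAct_mem h hx' i), ?_⟩
  · rw [LinearMap.mem_ker, Pi.sub_apply, map_sub, sub_eq_zero]
    have h1 := congrFun (matAct_map K.A f x') i
    simp_rw [hfx'] at h1
    rw [← h1]
    exact (congrFun hAx i).symm
  · rw [map_sub, hAy, ← matAct_mul, K.sq, matAct_zero, sub_zero]

/-- A bound on the Koszul homology bounds the degrees of generators. -/
theorem BoundedOn.mem_span {K : KoszulMatrix 𝒜} {V : Submodule S M} {b c : ℤ}
    (hV : K.BoundedOn ℳ V b) (hc : ∀ n x, n < c → x ∈ V → x ∈ ℳ n → x = 0) {n : ℤ} {x : M}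
    (hxV : x ∈ V) (hx : x ∈ ℳ n) :
    x ∈ Submodule.span S {x | ∃ n, c ≤ n ∧ n ≤ b ∧ x ∈ V ∧ x ∈ ℳ n} := by
  -- Induction on the distance above `c`, which terminates because `V` vanishes below `c`.
  suffices H : ∀ (d : ℕ) (n : ℤ) (x : M), n < c + d → x ∈ V → x ∈ ℳ n →
      x ∈ Submodule.span S {x | ∃ n, c ≤ n ∧ n ≤ b ∧ x ∈ V ∧ x ∈ ℳ n} from
    H (n - c + 1).toNat n x (by omega) hxV hx
  clear hxV hx x n
  intro d
  induction d with
  | zero =>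
    intro n x hn hxV hx
    rw [hc n x (by simpa using hn) hxV hx]
    exact zero_mem _
  | succ d ih =>
    intro n x hn hxV hx
    rcases lt_or_ge n c with hnc | hnc
    · rw [hc n x hnc hxV hx]
      exact zero_mem _
    rcases le_or_gt n b with hnb | hnb
    · exact Submodule.subset_span ⟨n, hnc, hnb, hxV, hx⟩
    -- In degree above `b` the cycle `x · base` bounds; its base coordinate writes `x` as a
    -- combination of elements of `V` of strictly smaller degree.
    obtain ⟨y, hyV, hy, hAy⟩ := hV n hnb (Pi.single K.base x) (fun i => by
        by_cases hi : i = K.base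
        · subst hi
          rwa [Pi.single_eq_same]
        · rw [Pi.single_eq_of_ne hi]
          exact V.zero_mem) (fun i => by
        by_cases hi : i = K.base
        · subst hi
          rwa [Pi.single_eq_same, K.wt_base, Nat.cast_zero, sub_zero]
        · rw [Pi.single_eq_of_ne hi]
          exact AddSubgroup.zero_mem _) (by
        ext i
        rw [matAct_apply, Finset.sum_eq_single K.base]
        · rw [K.col_base, zero_smul]; rfl
        · intro j _ hj
          rw [Pi.single_eq_of_ne hj, smul_zero]
        · exact fun hc => absurd (Finset.mem_univ _) hc)
    have hxy := congrFun hAy K.base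
    rw [Pi.single_eq_same, matAct_apply] at hxy
    rw [← hxy]
    refine sum_mem fun j _ => ?_
    obtain h0 | hj := K.row_base j
    · rw [h0, zero_smul]
      exact zero_mem _
    · exact Submodule.smul_mem _ _ (ih _ _ (by push_cast at hn; omega) (hyV j) (hy j))

/-- A projective cover of a module whose Koszul homology is bounded by `b` is generated
in degrees at most `b`. -/
theorem span_eq_top_of_boundedOn [GradedRing 𝒜] [IsLocalRing (𝒜 0)] (h : IsGradedModule 𝒜 ℳ)
    [Module.Finite S M] (h' : IsGradedModule 𝒜 𝒩)
    {f : M →ₗ[S] N} (hf : ∀ n x, x ∈ ℳ n → f x ∈ 𝒩 n)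
    (hmin : LinearMap.ker f ≤ homogeneousMaximalIdeal 𝒜 • ⊤) {b c : ℤ}
    (hc : ∀ n x, n < c → x ∈ LinearMap.range f → x ∈ 𝒩 n → x = 0)
    (hN : K.BoundedOn 𝒩 (LinearMap.range f) b) :
    Submodule.span S {x | ∃ n, c ≤ n ∧ n ≤ b ∧ x ∈ ℳ n} = ⊤ := by
  have hlift : ∀ n y, y ∈ LinearMap.range f → y ∈ 𝒩 n → ∃ x ∈ ℳ n, f x = y := fun n y hy hyn =>
    h.exists_homogeneous_preimage h' (r := 0) (fun n x hx => by rw [add_zero]; exact hf n x hx)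
      hy (by rwa [add_zero])
  have hrange : LinearMap.range f ≤
      (Submodule.span S {x | ∃ n, c ≤ n ∧ n ≤ b ∧ x ∈ ℳ n}).map f := by
    rintro _ ⟨x, rfl⟩
    induction x using h.induction with
    | zero => rw [map_zero]; exact zero_mem _
    | hom n x hx =>
      refine Submodule.span_le.mpr ?_ (hN.mem_span hc ⟨x, rfl⟩ (hf n x hx))
      rintro y ⟨m, hcm, hmb, hy, hym⟩
      obtain ⟨x', hx', rfl⟩ := hlift m y hy hym
      exact Submodule.mem_map_of_mem (Submodule.subset_span ⟨m, hcm, hmb, hx'⟩)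
    | add x y hx hy => rw [map_add]; exact add_mem hx hy
  -- Homogeneous lifts of generators of the image generate modulo the kernel, which minimality puts
  -- inside the maximal ideal times the module.
  refine h.eq_top_of_sup_smul_eq_top _ (fun n x hx => ?_) ?_
  · induction hx using Submodule.span_induction generalizing n with
    | mem x hx =>
      obtain ⟨m, hcm, hmb, hx⟩ := hx
      by_cases hmn : m = n
      · subst hmn
        rw [h.proj_of_mem hx]
        exact Submodule.subset_span ⟨m, hcm, hmb, hx⟩
      · rw [h.proj_of_ne hx hmn]
        exact zero_mem _
    | zero => rw [map_zero]; exact zero_mem _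
    | add x y _ _ hx hy => rw [map_add]; exact add_mem (hx n) (hy n)
    | smul s x _ hx =>
      induction s using DirectSum.Decomposition.inductionOn 𝒜 with
      | zero => rw [zero_smul, map_zero]; exact zero_mem _
      | homogeneous s => rw [h.proj_smul s.2]; exact Submodule.smul_mem _ _ (hx _)
      | add s t hs ht => rw [add_smul, map_add]; exact add_mem hs ht
  · rw [eq_top_iff]
    intro x _
    obtain ⟨y, hy, hyx⟩ := hrange ⟨x, rfl⟩
    rw [← add_sub_cancel y x]
    exact Submodule.add_mem_sup hy (hmin (by rw [LinearMap.mem_ker, map_sub, hyx, sub_self]))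

end KoszulMatrix

/-- Dependent choice for the inductive construction of chain maps: `P` is the invariant carried
along, `R` the compatibility of consecutive maps. -/
theorem exists_seq_of_step {α : ℕ → Type*} (P : ∀ i, α i → Prop) (R : ∀ i, α i → α (i + 1) → Prop)
    (h0 : ∃ x, P 0 x) (hs : ∀ i x, P i x → ∃ y, P (i + 1) y ∧ R i x y) :
    ∃ f : ∀ i, α i, (∀ i, P i (f i)) ∧ ∀ i, R i (f i) (f (i + 1)) := by
  choose g hg using hs
  let F : ∀ i, {x : α i // P i x} := fun i =>
    Nat.rec (motive := fun i => {x : α i // P i x}) ⟨h0.choose, h0.choose_spec⟩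
      (fun i x => ⟨g i x x.2, (hg i x x.2).1⟩) i
  exact ⟨fun i => F i, fun i => (F i).2, fun i => (hg i (F i) (F i).2).2⟩

/-- This is where the finite length of the complex enters the rigidity statement. -/
theorem exists_uniform_bound {P : ℕ → ℕ → Prop} (hmono : ∀ i b c, b ≤ c → P i b → P i c)
    (h : ∀ i, ∃ b, P i b) {l : ℕ} (hl : ∀ i, l < i → P i 0) : ∃ b, ∀ i, P i b := by
  choose b hb using h
  refine ⟨(Finset.range (l + 1)).sup b, fun i => ?_⟩
  rcases le_or_gt i l with hi | hi
  · exact hmono i _ _ (Finset.le_sup (by simpa using Nat.lt_succ_of_le hi)) (hb i)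
  · exact hmono i _ _ (Nat.zero_le _) (hl i hi)

theorem exists_bound_support {X : ℕ → Type*} [∀ i, AddCommGroup (X i)] (x : ⨁ i, X i) :
    ∃ m, ∀ j, m ≤ j → x j = 0 := by
  classical
  refine ⟨x.support.sup id + 1, fun j hj => ?_⟩
  by_contra hc
  have := Finset.le_sup (f := id) (DFinsupp.mem_support_iff.mpr hc)
  simp only [id] at this
  omega

/-! ### Morphisms out of folds, and degrees of cycles -/

namespace GradedComplex

theorem toModule_mem (F : GradedComplex.{u, v} 𝒜) {a : ℤ} (D : GradedDM.{u, w} 𝒜 a)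
    (φ : ∀ i, F.X i →ₗ[S] D.carrier)
    (hφ : ∀ i n x, x ∈ F.gr i n → φ i x ∈ D.gr (n + -(i * a))) {n : ℤ} (x : ⨁ i, F.X i)
    (hx : ∀ i, x i ∈ F.gr i (n + i * a)) : DirectSum.toModule S ℕ _ φ x ∈ D.gr n := by
  classical
  have hx' : x = ∑ i ∈ DFinsupp.support x, DirectSum.lof S ℕ F.X i (x i) :=
    (DirectSum.sum_support_of x).symm
  rw [hx', map_sum]
  refine sum_mem fun i _ => ?_
  rw [DirectSum.toModule_lof]
  have := hφ i _ _ (hx i)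
  rwa [add_neg_cancel_right] at this

/-- A morphism from a fold is given by a compatible family of homogeneous maps. -/
def foldHom (F : GradedComplex.{u, v} 𝒜) {a : ℤ} (D : GradedDM.{u, w} 𝒜 a)
    (φ : ∀ i, F.X i →ₗ[S] D.carrier)
    (hφ : ∀ i n x, x ∈ F.gr i n → φ i x ∈ D.gr (n + -(i * a)))
    (h0 : ∀ x, D.d (φ 0 x) = 0) (hs : ∀ i x, D.d (φ (i + 1) x) = φ i (F.d i x)) :
    (F.fold a).Hom D where
  toLin := DirectSum.toModule S ℕ _ φ
  map_mem n x hx := F.toModule_mem D φ hφ x hx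
  comm x := by
    change DirectSum.toModule S ℕ _ φ (F.foldD x) = _
    refine LinearMap.congr_fun (f := DirectSum.toModule S ℕ _ φ ∘ₗ F.foldD)
      (g := D.d ∘ₗ DirectSum.toModule S ℕ _ φ) (DirectSum.linearMap_ext S fun i => ?_) x
    refine LinearMap.ext fun y => ?_
    simp only [LinearMap.comp_apply, DirectSum.toModule_lof]
    cases i with
    | zero =>
      rw [h0, foldD, DirectSum.toModule_lof]
      exact map_zero _
    | succ i =>
      rw [hs, foldD, DirectSum.toModule_lof]
      exact DirectSum.toModule_lof S i _

theorem foldHom_lof (F : GradedComplex.{u, v} 𝒜) {a : ℤ} (D : GradedDM.{u, w} 𝒜 a)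
    (φ : ∀ i, F.X i →ₗ[S] D.carrier)
    (hφ : ∀ i n x, x ∈ F.gr i n → φ i x ∈ D.gr (n + -(i * a)))
    (h0 : ∀ x, D.d (φ 0 x) = 0) (hs : ∀ i x, D.d (φ (i + 1) x) = φ i (F.d i x)) (i : ℕ)
    (x : F.X i) : (F.foldHom D φ hφ h0 hs).toLin (DirectSum.lof S ℕ F.X i x) = φ i x :=
  DirectSum.toModule_lof S i x

theorem foldD_lof_succ (F : GradedComplex.{u, v} 𝒜) (i : ℕ) (x : F.X (i + 1)) :
    F.foldD (DirectSum.lof S ℕ F.X (i + 1) x) = DirectSum.lof S ℕ F.X i (F.d i x) :=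
  DirectSum.toModule_lof S (i + 1) x

theorem foldD_lof_zero (F : GradedComplex.{u, v} 𝒜) (x : F.X 0) :
    F.foldD (DirectSum.lof S ℕ F.X 0 x) = 0 :=
  DirectSum.toModule_lof S 0 x

theorem d_d (F : GradedComplex.{u, v} 𝒜) (i : ℕ) (x : F.X (i + 1 + 1)) :
    F.d i (F.d (i + 1) x) = 0 :=
  LinearMap.congr_fun (F.d_comp_d i) x

theorem proj_mem_range_d (F : GradedComplex.{u, v} 𝒜) (i : ℕ) (n : ℤ) {x : F.X i}
    (hx : x ∈ LinearMap.range (F.d i)) : (F.isGraded i).proj n x ∈ LinearMap.range (F.d i) := by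
  obtain ⟨y, rfl⟩ := hx
  rw [(F.isGraded (i + 1)).proj_comm_zero (F.isGraded i) (F.d_mem i)]
  exact ⟨_, rfl⟩

theorem proj_mem_cycles (F : GradedComplex.{u, v} 𝒜) (i : ℕ) (n : ℤ) {x : F.X i}
    (hx : x ∈ F.cycles i) : (F.isGraded i).proj n x ∈ F.cycles i := by
  cases i with
  | zero => trivial
  | succ i =>
    change F.d i _ = 0
    rw [← (F.isGraded (i + 1)).proj_comm_zero (F.isGraded i) (F.d_mem i)]
    rw [show F.d i x = 0 from hx, map_zero]

/-- If the homology is of finite length, all cycles of large absolute degree are boundaries. -/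
theorem exists_bound_cycles [GradedRing 𝒜] [IsNoetherianRing S] (F : GradedComplex.{u, v} 𝒜)
    (i : ℕ) [Module.Finite S (F.X i)] (hF : IsFiniteLength S (F.Homology i)) :
    ∃ B : ℕ, ∀ (n : ℤ) (x : F.X i), (B : ℤ) ≤ |n| → x ∈ F.gr i n → x ∈ F.cycles i →
      x ∈ LinearMap.range (F.d i) := by
  have hZ := (F.isGraded i).submodule (F.cycles i) (fun n x => F.proj_mem_cycles i n)
  have := (isFiniteLength_iff_isNoetherian_isArtinian.mp hF).2
  obtain ⟨B, hB⟩ := hZ.exists_bound_of_artinian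
    ((LinearMap.range (F.d i)).submoduleOf (F.cycles i)).mkQ (fun n x hx => by
      rw [Submodule.mkQ_apply, Submodule.Quotient.mk_eq_zero] at hx ⊢
      have := hZ.proj_comm_zero (F.isGraded i) (f := (F.cycles i).subtype) (fun _ _ h => h) n x
      change (F.cycles i).subtype (hZ.proj n x) ∈ LinearMap.range (F.d i)
      rw [← this]
      exact F.proj_mem_range_d i n hx)
  refine ⟨B, fun n x hn hx hxZ => ?_⟩
  have := hB n ⟨x, hxZ⟩ hn hx
  rwa [Submodule.mkQ_apply, Submodule.Quotient.mk_eq_zero] at this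

end GradedComplex

/-! ### Rigidity of free flags -/

namespace FreeFlag

variable {a : ℤ}

theorem anchorD_mem (D : FreeFlag.{u, v} 𝒜 a) (i : ℕ) (n : ℤ) (x : D.X (i + 1))
    (hx : x ∈ D.gr (i + 1) n) : D.anchorD i x ∈ D.gr i (n + a) :=
  D.d_mem _ _ (of_mem_sumGrading (g := D.gr) hx) i

/-- A homogeneous cycle in the `m`-th step of a free flag bounds if the homology of the anchor
vanishes in the relevant degrees. -/
theorem exists_bounding (D : FreeFlag.{u, v} 𝒜 a) (q : ℤ) (m : ℕ)
    (hH : ∀ j < m, ∀ x ∈ D.gr j q, x ∈ D.anchor.cycles j → x ∈ LinearMap.range (D.anchorD j))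
    (z : ⨁ i, D.X i) (hz : z ∈ sumGrading D.gr q) (hzm : ∀ j, m ≤ j → z j = 0)
    (hdz : D.d z = 0) : ∃ y : ⨁ i, D.X i, (∀ j, m < j → y j = 0) ∧ D.d y = z := by
  induction m generalizing z with
  | zero =>
    refine ⟨0, fun _ _ => rfl, ?_⟩
    rw [map_zero]
    exact DFinsupp.ext fun j => (hzm j (Nat.zero_le j)).symm
  | succ m ih =>
    -- The top component of a cycle of the flag is a cycle of the anchor, since lower pieces cannot
    -- contribute one step below it.
    have hcyc : z m ∈ D.anchor.cycles m := by
      cases m with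
      | zero => trivial
      | succ k =>
        change D.anchorD k (z (k + 1)) = 0
        rw [← D.d_apply_of_top k z (fun j hj => hzm j hj), hdz]
        rfl
    obtain ⟨x, hx, hxz⟩ := (D.isGraded (m + 1)).exists_homogeneous_preimage (D.isGraded m)
      (D.anchorD_mem m) (n := q - a) (hH m (Nat.lt_succ_self m) _ (hz m) hcyc)
      (by rw [sub_add_cancel]; exact hz m)
    have hlof := D.d_mem _ _ (of_mem_sumGrading (g := D.gr) hx)
    rw [sub_add_cancel] at hlof
    -- Subtracting the boundary of `x` kills the top component and leaves a cycle of the same degree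
    -- in a smaller step.
    obtain ⟨y, hy, hdy⟩ := ih (fun j hj => hH j (by omega))
      (z - D.d (DirectSum.lof S ℕ D.X (m + 1) x)) (sub_mem hz hlof) (fun j hj => by
        rw [DirectSum.sub_apply]
        rcases Nat.eq_or_lt_of_le hj with rfl | hj'
        · exact sub_eq_zero.mpr hxz.symm
        · rw [hzm j hj', D.d_flag _ x j hj', sub_zero])
      (by rw [map_sub, hdz, zero_sub, neg_eq_zero]; exact LinearMap.congr_fun D.d_comp_d _)
    refine ⟨y + DirectSum.lof S ℕ D.X (m + 1) x, fun j hj => ?_, ?_⟩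
    · rw [DirectSum.add_apply, hy j (by omega), DirectSum.lof_eq_of,
        DirectSum.of_eq_of_ne _ _ _ (by omega), add_zero]
    · rw [map_add, hdy, sub_add_cancel]

/-- A map into `⨁ i, X i` that is triangular with bijective diagonal is bijective. -/
theorem bijective_of_triangular {X Y : ℕ → Type*} [∀ i, AddCommGroup (X i)]
    [∀ i, Module S (X i)] [∀ i, AddCommGroup (Y i)] [∀ i, Module S (Y i)]
    (e : ∀ i, Y i ≃ₗ[S] X i) (Φ : (⨁ i, X i) →ₗ[S] ⨁ i, Y i)
    (hlow : ∀ i x j, i < j → Φ (DirectSum.lof S ℕ X i x) j = 0)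
    (hdiag : ∀ i x, Φ (DirectSum.lof S ℕ X i x) i = (e i).symm x) : Function.Bijective Φ := by
  classical
  -- Leading components are transported by the diagonal, so both injectivity and surjectivity follow
  -- by induction on the support.
  have htop : ∀ m (x : ⨁ i, X i), (∀ j, m < j → x j = 0) → Φ x m = (e m).symm (x m) := by
    intro m x hx
    have hc : Φ x m = DirectSum.component S ℕ Y m (Φ x) := rfl
    have hx' : x = ∑ i ∈ DFinsupp.support x, DirectSum.lof S ℕ X i (x i) :=
      (DirectSum.sum_support_of x).symm
    rw [hc]
    conv_lhs => rw [hx']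
    rw [map_sum, map_sum, Finset.sum_eq_single m]
    · exact hdiag m (x m)
    · intro j _ hj
      rcases lt_or_gt_of_ne hj with h | h
      · exact hlow j (x j) m h
      · rw [hx j h, map_zero, map_zero, map_zero]
    · intro h
      rw [DFinsupp.notMem_support_iff.mp h, map_zero, map_zero, map_zero]
  refine ⟨(injective_iff_map_eq_zero Φ).mpr fun x hx => ?_, fun y => ?_⟩
  · obtain ⟨m, hm⟩ := exists_bound_support x
    induction m with
    | zero => exact DFinsupp.ext fun j => hm j (Nat.zero_le j)
    | succ m ih =>
      refine ih fun j hj => ?_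
      rcases Nat.eq_or_lt_of_le hj with rfl | hj
      · have := htop m x (fun j hj => hm j hj)
        rw [hx] at this
        exact (e m).symm.map_eq_zero_iff.mp this.symm
      · exact hm j hj
  · obtain ⟨m, hm⟩ := exists_bound_support y
    induction m generalizing y with
    | zero => exact ⟨0, by rw [map_zero]; exact DFinsupp.ext fun j => (hm j (Nat.zero_le j)).symm⟩
    | succ m ih =>
      obtain ⟨x, hx⟩ := ih (y - Φ (DirectSum.lof S ℕ X m (e m (y m)))) (fun j hj => by
        rw [DirectSum.sub_apply]
        rcases Nat.eq_or_lt_of_le hj with rfl | hj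
        · rw [hdiag, LinearEquiv.symm_apply_apply, sub_self]
        · rw [hm j hj, hlow _ _ j hj, sub_zero])
      exact ⟨x + DirectSum.lof S ℕ X m (e m (y m)), by rw [map_add, hx, sub_add_cancel]⟩

end FreeFlag

/-- A bijective morphism gives an isomorphism of differential modules. -/
theorem GradedDM.isIsomorphic_of_bijective {a : ℤ} {D : GradedDM.{u, v} 𝒜 a}
    {E : GradedDM.{u, w} 𝒜 a} (φ : D.Hom E) (hφ : Function.Bijective φ.toLin) :
    E.IsIsomorphic D := by
  let e := LinearEquiv.ofBijective φ.toLin hφ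
  have he : ∀ x, e x = φ.toLin x := fun _ => rfl
  refine ⟨e.symm, fun n x => ⟨fun hx => ?_, fun hx => ?_⟩, fun x => ?_⟩
  · obtain ⟨y, hy, rfl⟩ := D.isGraded.exists_homogeneous_preimage E.isGraded (f := φ.toLin) (r := 0)
      (fun n x hx => by rw [add_zero]; exact φ.map_mem n x hx) (hφ.2 x) (n := n)
      (by rwa [add_zero])
    rwa [← he, e.symm_apply_apply]
  · have := φ.map_mem n _ hx
    rwa [← he, e.apply_symm_apply] at this
  · rw [LinearEquiv.symm_apply_eq, he, φ.comm, ← he, e.apply_symm_apply]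

/-- Free flags anchored on a complex with bounded generators and bounded homology are folds. -/
theorem FreeFlag.isIsomorphic_fold [GradedRing 𝒜] (F : GradedComplex.{u, v} 𝒜)
    (hfree : ∀ i, Module.Free S (F.X i)) {B B' : ℕ}
    (hB : ∀ i, Submodule.span S {x | ∃ n : ℤ, |n| ≤ B ∧ x ∈ F.gr i n} = ⊤)
    (hB' : ∀ i (n : ℤ) (x : F.X i), (B' : ℤ) ≤ |n| → x ∈ F.gr i n → x ∈ F.cycles i →
      x ∈ LinearMap.range (F.d i)) {a : ℤ} (ha : (B : ℤ) + B' ≤ |a|)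
    (D : FreeFlag.{u, v} 𝒜 a) (e : ∀ i, D.X i ≃ₗ[S] F.X i)
    (hgr : ∀ i n x, x ∈ D.gr i (n + -(i * a)) ↔ e i x ∈ F.gr i n)
    (hd : ∀ i x, e i (D.anchorD i x) = F.d i (e (i + 1) x)) :
    D.toGradedDM.IsIsomorphic (F.fold a) := by
  have hgr' : ∀ i n x, x ∈ F.gr i n → (e i).symm x ∈ D.gr i (n + -(i * a)) := fun i n x hx =>
    (hgr i n ((e i).symm x)).mpr (by rwa [LinearEquiv.apply_symm_apply])
  have hdsymm : ∀ i x, D.anchorD i ((e (i + 1)).symm x) = (e i).symm (F.d i x) := fun i x => by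
    rw [LinearEquiv.eq_symm_apply, hd, LinearEquiv.apply_symm_apply]
  have hDgr := IsGradedModule.sum D.isGraded
  have hDD : ∀ x, D.d (D.d x) = 0 := fun x => LinearMap.congr_fun D.d_comp_d x
  have hvanish : ∀ i j (p : ℤ), |p| ≤ B → j < i → ∀ x ∈ D.gr j (p + -(i * a)),
      x ∈ D.anchor.cycles j → x ∈ LinearMap.range (D.anchorD j) := by
    intro i j p hp hji x hx hxc
    have hdeg : e j x ∈ F.gr j (p + -(i * a) + j * a) :=
      (hgr j _ x).mp (by rwa [add_neg_cancel_right])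
    obtain ⟨k, rfl⟩ := Nat.exists_eq_add_of_lt hji
    -- With `i - j = k + 1`, the degree in `F_j` is `p - (k+1)a`, of absolute value at least
    -- `(k+1)|a| - B ≥ B'`.
    obtain ⟨y, hy⟩ := hB' j _ (e j x) (by
      have h1 : p + -(((j + k + 1 : ℕ) : ℤ) * a) + j * a = p - (k + 1) * a := by push_cast; ring
      have h2 : |((k : ℤ) + 1) * a| = ((k : ℤ) + 1) * |a| := by
        rw [abs_mul, abs_of_nonneg (by positivity)]
      have h3 : |((k : ℤ) + 1) * a| - |p| ≤ |p - (k + 1) * a| := by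
        rw [abs_sub_comm p]
        exact abs_sub_abs_le_abs_sub _ _
      rw [h1]
      nlinarith [abs_nonneg a, Int.natCast_nonneg k]) hdeg (by
        cases j with
        | zero => trivial
        | succ j =>
          change F.d j (e (j + 1) x) = 0
          rw [← hd j x, show D.anchorD j x = 0 from hxc, map_zero])
    exact ⟨(e (j + 1)).symm y, by rw [hdsymm, hy, LinearEquiv.symm_apply_apply]⟩
  -- The invariant records homogeneity, triangularity, the prescribed diagonal, and that `φ_i ∂`
  -- takes values in cycles, which allows the next step.
  obtain ⟨φ, hP, hR⟩ := exists_seq_of_step (α := fun i => F.X i →ₗ[S] ⨁ i, D.X i)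
    (fun i φ => (∀ n x, x ∈ F.gr i n → φ x ∈ sumGrading D.gr (n + -(i * a))) ∧
      (∀ x j, i < j → φ x j = 0) ∧ (∀ x, φ x i = (e i).symm x) ∧
      ∀ x, D.d (φ (F.d i x)) = 0)
    (fun i φ ψ => (∀ x, D.d (ψ x) = φ (F.d i x))) (by
      refine ⟨DirectSum.lof S ℕ D.X 0 ∘ₗ (e 0).symm.toLinearMap,
        fun n x hx => of_mem_sumGrading (hgr' 0 n x hx), fun x j hj => ?_, fun x => ?_,
        fun x => DFinsupp.ext fun j => D.d_flag 0 _ j (Nat.zero_le j)⟩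
      · exact DirectSum.of_eq_of_ne _ _ _ (by omega)
      · exact DirectSum.of_eq_same _ _) (by
      rintro i φ ⟨hdeg, hlow, hdiag, hcyc⟩
      have := hfree (i + 1)
      -- Corrections are sought in the pieces `j ≤ i` only, so the diagonal entry of `φ_{i+1}` is
      -- unaffected.
      let V : Submodule S (⨁ i, D.X i) :=
        { carrier := {y | ∀ j, i < j → y j = 0}
          zero_mem' := fun _ _ => rfl
          add_mem' := fun hx hy j hj => by rw [DirectSum.add_apply, hx j hj, hy j hj, add_zero]
          smul_mem' := fun s x hx j hj => by rw [DirectSum.smul_apply, hx j hj, smul_zero] }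
      have hV := hDgr.submodule V (fun n y hy j hj => by
        have := hDgr.proj_comm_zero (D.isGraded j) (f := DirectSum.component S ℕ D.X j)
          (fun n x hx => hx j) n y
        refine this.symm.trans ?_
        rw [show DirectSum.component S ℕ D.X j y = 0 from hy j hj, map_zero])
      -- The error of the leading term. Its `i`-th component vanishes because the anchor is
      -- isomorphic to `F`.
      let f : F.X (i + 1) →ₗ[S] ⨁ i, D.X i := φ ∘ₗ F.d i -
        D.d ∘ₗ DirectSum.lof S ℕ D.X (i + 1) ∘ₗ (e (i + 1)).symm.toLinearMap
      have hfdeg : ∀ n x, x ∈ F.gr (i + 1) n →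
          f x ∈ sumGrading D.gr (n + -(((i + 1 : ℕ) : ℤ) * a) + a) := fun n x hx => by
        refine sub_mem ?_ (D.d_mem _ _ (of_mem_sumGrading (hgr' (i + 1) n x hx)))
        have := hdeg n _ (F.d_mem i n x hx)
        rwa [show n + -(((i + 1 : ℕ) : ℤ) * a) + a = n + -(i * a) by push_cast; ring]
      have hflow : ∀ x j, i ≤ j → f x j = 0 := fun x j hj => by
        change (φ (F.d i x) - D.d (DirectSum.lof S ℕ D.X (i + 1) ((e (i + 1)).symm x))) j = 0
        rw [DirectSum.sub_apply]
        rcases Nat.eq_or_lt_of_le hj with rfl | hj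
        · rw [hdiag, ← hdsymm]
          exact sub_self _
        · rw [hlow _ j hj, D.d_flag _ _ j hj, sub_zero]
      obtain ⟨k, hk, hkdeg⟩ := exists_graded_lift (F.isGraded (i + 1)) hV hDgr f
        (D.d ∘ₗ V.subtype) (-(((i + 1 : ℕ) : ℤ) * a)) a hfdeg
        (fun n x hx => D.d_mem n x hx) (by
          -- Being a boundary is a linear condition, so it suffices to test it on generators, where
          -- the degree estimate applies.
          have hle : Submodule.span S {x | ∃ n : ℤ, |n| ≤ B ∧ x ∈ F.gr (i + 1) n} ≤
              (LinearMap.range (D.d ∘ₗ V.subtype)).comap f := by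
            rw [Submodule.span_le]
            rintro x ⟨p, hp, hx⟩
            have hfx := hfdeg p x hx
            rw [show p + -(((i + 1 : ℕ) : ℤ) * a) + a = p + -(i * a) by push_cast; ring] at hfx
            obtain ⟨y, hy, hdy⟩ := D.exists_bounding _ i (fun j hj => hvanish i j p hp hj) (f x)
              hfx (hflow x) (by
                change D.d (φ (F.d i x) - D.d _) = 0
                rw [map_sub, hcyc, hDD, sub_zero])
            exact ⟨⟨y, hy⟩, hdy⟩
          rw [hB (i + 1)] at hle
          exact fun x => hle trivial)
      have hk' : ∀ x, D.d (k x) = φ (F.d i x) -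
        D.d (DirectSum.lof S ℕ D.X (i + 1) ((e (i + 1)).symm x)) := hk
      have hR : ∀ x, D.d (DirectSum.lof S ℕ D.X (i + 1) ((e (i + 1)).symm x) + k x) =
          φ (F.d i x) := fun x => by rw [map_add, hk', add_sub_cancel]
      refine ⟨DirectSum.lof S ℕ D.X (i + 1) ∘ₗ (e (i + 1)).symm.toLinearMap + V.subtype ∘ₗ k,
        ⟨fun n x hx => add_mem (of_mem_sumGrading (hgr' (i + 1) n x hx)) (hkdeg n x hx),
          fun x j hj => ?_, fun x => ?_, fun x => ?_⟩, hR⟩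
      · change (DirectSum.lof S ℕ D.X (i + 1) ((e (i + 1)).symm x) + (k x : ⨁ i, D.X i)) j = 0
        rw [DirectSum.add_apply, (k x).2 j (by omega), DirectSum.lof_eq_of,
          DirectSum.of_eq_of_ne _ _ _ (by omega), add_zero]
      · change (DirectSum.lof S ℕ D.X (i + 1) ((e (i + 1)).symm x) + (k x : ⨁ i, D.X i)) _ = _
        rw [DirectSum.add_apply, (k x).2 (i + 1) (by omega), DirectSum.lof_eq_of,
          DirectSum.of_eq_same, add_zero]
      · refine (hR _).trans ?_
        rw [F.d_d, map_zero])
  have h0 : ∀ x, D.d (φ 0 x) = 0 := fun x => by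
    have hx : φ 0 x = DirectSum.lof S ℕ D.X 0 ((e 0).symm x) := by
      refine DFinsupp.ext fun j => ?_
      cases j with
      | zero =>
        refine ((hP 0).2.2.1 x).trans ?_
        exact (DirectSum.of_eq_same _ _).symm
      | succ j =>
        refine ((hP 0).2.1 x (j + 1) (Nat.succ_pos j)).trans ?_
        exact (DirectSum.of_eq_of_ne _ _ _ (Nat.succ_ne_zero j)).symm
    rw [hx]
    exact DFinsupp.ext fun j => D.d_flag 0 _ j (Nat.zero_le j)
  have hlof := F.foldHom_lof D.toGradedDM φ (fun i => (hP i).1) h0 hR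
  refine GradedDM.isIsomorphic_of_bijective (F.foldHom D.toGradedDM φ (fun i => (hP i).1) h0 hR)
    (FreeFlag.bijective_of_triangular e _ (fun i x j hij => ?_) fun i x => ?_)
  · exact (congrArg (fun y : ⨁ i, D.X i => y j) (hlof i x)).trans ((hP i).2.1 x j hij)
  · exact (congrArg (fun y : ⨁ i, D.X i => y i) (hlof i x)).trans ((hP i).2.2.1 x)

/-- Finite free complexes with finite length homology are `a`-rigid for `|a| ≫ 0`. -/
theorem GradedComplex.IsFiniteFree.exists_isRigid [GradedRing 𝒜] [IsNoetherianRing S]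
    {F : GradedComplex.{u, v} 𝒜} (hF : F.IsFiniteFree) (hH : F.HasFiniteLengthHomology) :
    ∃ N : ℕ, ∀ a : ℤ, (N : ℤ) ≤ |a| → F.IsRigid a := by
  obtain ⟨hfree, l, hl⟩ := hF
  have := fun i => (hfree i).2
  obtain ⟨B, hB⟩ := exists_uniform_bound
    (P := fun i B => Submodule.span S {x | ∃ n : ℤ, |n| ≤ B ∧ x ∈ F.gr i n} = ⊤)
    (fun i b c hbc h => by
      rw [eq_top_iff, ← h]
      refine Submodule.span_mono ?_
      rintro x ⟨n, hn, hx⟩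
      exact ⟨n, hn.trans (by exact_mod_cast hbc), hx⟩)
    (fun i => (F.isGraded i).exists_bound_generators) (l := l)
    (fun i hi => by have := hl i hi; exact Subsingleton.elim _ _)
  obtain ⟨B', hB'⟩ := exists_uniform_bound
    (P := fun i (B : ℕ) => ∀ (n : ℤ) (x : F.X i), (B : ℤ) ≤ |n| → x ∈ F.gr i n →
      x ∈ F.cycles i → x ∈ LinearMap.range (F.d i))
    (fun i b c hbc h n x hn => h n x (le_trans (by exact_mod_cast hbc) hn))
    (fun i => F.exists_bound_cycles i (hH i)) (l := l)
    (fun i hi n x _ _ _ => by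
      have := hl i hi
      rw [Subsingleton.elim x 0]
      exact zero_mem _)
  refine ⟨B + B', fun a ha D => ?_⟩
  rintro ⟨e, hgr, hd⟩
  exact D.isIsomorphic_fold F (fun i => (hfree i).1) hB hB' (by exact_mod_cast ha) e hgr hd

/-! ### Linear growth of minimal resolutions -/

/-- One step of the degree bound for minimal resolutions. -/
theorem KoszulMatrix.bounds_step {M : Type v} [AddCommGroup M] [Module S M]
    {ℳ : ℤ → AddSubgroup M} {N : Type w} [AddCommGroup N] [Module S N] {𝒩 : ℤ → AddSubgroup N}
    [GradedRing 𝒜] [IsLocalRing (𝒜 0)] (K : KoszulMatrix 𝒜) {E : ℕ}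
    (hE : K.BoundedOn (ringGr 𝒜) ⊤ E) (h : IsGradedModule 𝒜 ℳ) [Module.Finite S M]
    [Module.Projective S M] (h' : IsGradedModule 𝒜 𝒩)
    {f : M →ₗ[S] N} (hf : ∀ n x, x ∈ ℳ n → f x ∈ 𝒩 n)
    (hmin : LinearMap.ker f ≤ homogeneousMaximalIdeal 𝒜 • ⊤) {b c : ℤ}
    (hc : ∀ n x, n < c → x ∈ LinearMap.range f → x ∈ 𝒩 n → x = 0)
    (hN : K.BoundedOn 𝒩 (LinearMap.range f) b) :
    Submodule.span S {x | ∃ n, c ≤ n ∧ n ≤ b ∧ x ∈ ℳ n} = ⊤ ∧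
      K.BoundedOn ℳ (LinearMap.ker f) (b + E) := by
  have hspan := K.span_eq_top_of_boundedOn h h' hf hmin hc hN
  refine ⟨hspan, K.boundedOn_ker h h' hf (by omega) (K.boundedOn_of_projective h hE ?_) hN⟩
  rw [eq_top_iff, ← hspan]
  refine Submodule.span_mono ?_
  rintro x ⟨n, -, hn, hx⟩
  exact ⟨n, hn, hx⟩

/-- The degrees of the generators of a minimal free resolution grow at most linearly. -/
theorem IsMinimalFreeResolution.span_eq_top {M : Type w} [AddCommGroup M] [Module S M]
    {ℳ : ℤ → AddSubgroup M} [GradedRing 𝒜] [IsLocalRing (𝒜 0)] (hℳ : IsGradedModule 𝒜 ℳ)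
    (K : KoszulMatrix 𝒜) {E : ℕ} (hE : K.BoundedOn (ringGr 𝒜) ⊤ E) {b c : ℤ}
    (hb : K.BoundedOn ℳ ⊤ b) (hc : ∀ n x, n < c → x ∈ ℳ n → x = 0)
    {F : GradedComplex.{u, v} 𝒜} {ε : F.X 0 →ₗ[S] M} (hF : IsMinimalFreeResolution F ℳ ε) (i : ℕ) :
    Submodule.span S {x | ∃ n, c ≤ n ∧ n ≤ b + i * E ∧ x ∈ F.gr i n} = ⊤ := by
  have := hF.free
  have := hF.finite
  have hproj : ∀ i, Module.Projective S (F.X i) := fun i => Module.Projective.of_free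
  -- The Koszul bound on the next syzygy is carried along, since it controls the generators one step
  -- later.
  suffices H : Submodule.span S {x | ∃ n, c ≤ n ∧ n ≤ b + i * E ∧ x ∈ F.gr i n} = ⊤ ∧
      K.BoundedOn (F.gr i) (LinearMap.range (F.d i)) (b + i * E + E) from H.1
  induction i with
  | zero =>
    have hker : LinearMap.ker ε = LinearMap.range (F.d 0) := hF.exact_zero.linearMap_ker_eq
    have := K.bounds_step hE (F.isGraded 0) hℳ hF.aug_mem (hker ▸ hF.minimal 0)
      (fun n x hn _ hx => hc n x hn hx)
      (by rw [LinearMap.range_eq_top.mpr hF.surjective]; exact hb)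
    rw [hker] at this
    simpa using this
  | succ i ih =>
    have hker : LinearMap.ker (F.d i) = LinearMap.range (F.d (i + 1)) :=
      (hF.exact i).linearMap_ker_eq
    have hlow : Submodule.span S {x | ∃ n, c ≤ n ∧ x ∈ F.gr i n} = ⊤ := by
      rw [eq_top_iff, ← ih.1]
      refine Submodule.span_mono ?_
      rintro x ⟨n, hn, -, hx⟩
      exact ⟨n, hn, hx⟩
    have := K.bounds_step hE (F.isGraded (i + 1)) (F.isGraded i) (F.d_mem i)
      (hker ▸ hF.minimal (i + 1))
      (fun n x hn _ hx => (F.isGraded i).eq_zero_of_span_eq_top hlow hx hn) ih.2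
    rw [hker] at this
    rw [show b + ((i + 1 : ℕ) : ℤ) * E = b + i * E + E by push_cast; ring]
    exact this

/-! ### Quasi-isomorphisms out of folds of resolutions -/

namespace GradedDM

variable {a : ℤ}

theorem proj_mem_ker (D : GradedDM.{u, v} 𝒜 a) (n : ℤ) {x : D.carrier}
    (hx : x ∈ LinearMap.ker D.d) : D.isGraded.proj n x ∈ LinearMap.ker D.d := by
  rw [LinearMap.mem_ker] at hx ⊢
  have := D.isGraded.proj_comm D.isGraded (f := D.d.toAddMonoidHom) D.d_mem n x
  refine this.symm.trans ?_
  change D.isGraded.proj (n + a) (D.d x) = 0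
  rw [hx, map_zero]

theorem mk_mem_homologyGr (D : GradedDM.{u, v} 𝒜 a) {n : ℤ} {x : LinearMap.ker D.d}
    (hx : (x : D.carrier) ∈ D.gr n) :
    ((LinearMap.range D.d).submoduleOf (LinearMap.ker D.d)).mkQ x ∈ D.homologyGr n :=
  ⟨x, hx, rfl⟩

end GradedDM

namespace GradedComplex

/-- A cycle of the fold of an acyclic complex is homologous to an element of `F_0`. -/
theorem exists_eq_lof_add_foldD (F : GradedComplex.{u, v} 𝒜)
    (hF : ∀ i, Function.Exact (F.d (i + 1)) (F.d i)) (z : ⨁ i, F.X i) (hz : F.foldD z = 0) :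
    ∃ x y, z = DirectSum.lof S ℕ F.X 0 x + F.foldD y := by
  classical
  -- The differential maps distinct pieces to distinct pieces, so each component of the cycle is
  -- itself a cycle, and a boundary in positive homological degree.
  have hmem : z ∈ LinearMap.range (DirectSum.lof S ℕ F.X 0) ⊔ LinearMap.range F.foldD := by
    have hz' : z = ∑ i ∈ DFinsupp.support z, DirectSum.lof S ℕ F.X i (z i) :=
      (DirectSum.sum_support_of z).symm
    rw [hz']
    refine sum_mem fun i _ => ?_
    cases i with
    | zero => exact Submodule.mem_sup_left ⟨_, rfl⟩
    | succ i =>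
      refine Submodule.mem_sup_right ?_
      have h0 : F.d i (z (i + 1)) = 0 := by rw [← foldD_apply, hz]; rfl
      obtain ⟨w, hw⟩ := (hF i _).mp h0
      exact ⟨DirectSum.lof S ℕ F.X (i + 1 + 1) w, by rw [foldD_lof_succ, hw]⟩
  obtain ⟨_, ⟨x, rfl⟩, _, ⟨y, rfl⟩, hxy⟩ := Submodule.mem_sup.mp hmem
  exact ⟨x, y, hxy.symm⟩

/-- A morphism from the fold of a resolution of `M` that induces the given isomorphism
on homology via `F_0` is a quasi-isomorphism. -/
theorem isQuasiIso_of_resolution {M : Type w} [AddCommGroup M] [Module S M]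
    (F : GradedComplex.{u, v} 𝒜) {ε : F.X 0 →ₗ[S] M}
    (hF : ∀ i, Function.Exact (F.d (i + 1)) (F.d i)) (hε : Function.Exact (F.d 0) ε)
    (hsurj : Function.Surjective ε) {a : ℤ} (D : GradedDM.{u, u'} 𝒜 a)
    (e : D.Homology ≃ₗ[S] M) (Φ : (F.fold a).Hom D) (k : F.X 0 →ₗ[S] LinearMap.ker D.d)
    (hk : ∀ x, e (((LinearMap.range D.d).submoduleOf (LinearMap.ker D.d)).mkQ (k x)) = ε x)
    (hΦ : ∀ x, Φ.toLin (DirectSum.lof S ℕ F.X 0 x) = k x) : Φ.IsQuasiIso := by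
  have hmk : ∀ z : LinearMap.ker D.d,
      ((LinearMap.range D.d).submoduleOf (LinearMap.ker D.d)).mkQ z = 0 ↔
        (z : D.carrier) ∈ LinearMap.range D.d := fun z => by
    rw [Submodule.mkQ_apply, Submodule.Quotient.mk_eq_zero]
    rfl
  refine ⟨(injective_iff_map_eq_zero _).mpr fun x hx => ?_, fun y => ?_⟩
  · obtain ⟨⟨z, hz⟩, rfl⟩ := Submodule.Quotient.mk_surjective _ x
    obtain ⟨x, y, hxy⟩ := F.exists_eq_lof_add_foldD hF z hz
    have h1 : Φ.toLin z ∈ LinearMap.range D.d := (hmk (Φ.cyclesMap ⟨z, hz⟩)).mp hx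
    have h2 : Φ.toLin z = k x + D.d (Φ.toLin y) := by
      refine (congrArg Φ.toLin hxy).trans ((map_add Φ.toLin _ _).trans ?_)
      exact congrArg₂ (· + ·) (hΦ x) (Φ.comm y)
    have h3 : (k x : D.carrier) ∈ LinearMap.range D.d := by
      rw [← add_sub_cancel_right (k x : D.carrier) (D.d (Φ.toLin y)), ← h2]
      exact sub_mem h1 ⟨_, rfl⟩
    have h4 : ε x = 0 := by rw [← hk, (hmk (k x)).mpr h3, map_zero]
    obtain ⟨w, rfl⟩ := (hε x).mp h4
    refine (Submodule.Quotient.mk_eq_zero _).mpr ?_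
    refine ⟨DirectSum.lof S ℕ F.X 1 w + y, ?_⟩
    change F.foldD (DirectSum.lof S ℕ F.X 1 w + y) = z
    rw [map_add, foldD_lof_succ, hxy]
  · obtain ⟨x, hx⟩ := hsurj (e y)
    refine ⟨Submodule.Quotient.mk ⟨DirectSum.lof S ℕ F.X 0 x, F.foldD_lof_zero x⟩, ?_⟩
    rw [← e.injective.eq_iff, ← hx, ← hk]
    refine congrArg (fun z => e (Submodule.Quotient.mk z)) (Subtype.ext ?_)
    exact hΦ x

/-- Construction of a quasi-isomorphism from the fold of a resolution of `M` to `D`, if `M`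
vanishes in the degrees of the obstructions. -/
theorem exists_isQuasiIso [GradedRing 𝒜] {M : Type w} [AddCommGroup M] [Module S M]
    {ℳ : ℤ → AddSubgroup M} (hℳ : IsGradedModule 𝒜 ℳ)
    (F : GradedComplex.{u, v} 𝒜) {ε : F.X 0 →ₗ[S] M} (hproj : ∀ i, Module.Projective S (F.X i))
    (hF : ∀ i, Function.Exact (F.d (i + 1)) (F.d i)) (hε : Function.Exact (F.d 0) ε)
    (hsurj : Function.Surjective ε) (haug : ∀ n x, x ∈ F.gr 0 n → ε x ∈ ℳ n) {a : ℤ}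
    (hvan : ∀ i : ℕ, Submodule.span S
      {x | ∃ p : ℤ, (∀ m ∈ ℳ (p + -(((i + 1 : ℕ) : ℤ) * a)), m = 0) ∧
        x ∈ F.gr (i + 1 + 1) p} = ⊤)
    (D : GradedDM.{u, u'} 𝒜 a) (hD : D.HasHomology ℳ) :
    ∃ Φ : (F.fold a).Hom D, Φ.IsQuasiIso := by
  obtain ⟨e, he⟩ := hD
  have hZ := D.isGraded.submodule (LinearMap.ker D.d) (fun n x hx => D.proj_mem_ker n hx)
  let g : LinearMap.ker D.d →ₗ[S] M :=
    e.toLinearMap ∘ₗ ((LinearMap.range D.d).submoduleOf (LinearMap.ker D.d)).mkQ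
  have hgdeg : ∀ n (x : LinearMap.ker D.d), (x : D.carrier) ∈ D.gr n → g x ∈ ℳ n :=
    fun n x hx => (he n _).mp (D.mk_mem_homologyGr hx)
  have hg0 : ∀ x : LinearMap.ker D.d, g x = 0 → (x : D.carrier) ∈ LinearMap.range D.d := by
    intro x hx
    have := e.map_eq_zero_iff.mp hx
    rwa [Submodule.mkQ_apply, Submodule.Quotient.mk_eq_zero] at this
  obtain ⟨k, hk, hkdeg⟩ := exists_graded_lift (F.isGraded 0) hZ hℳ ε g 0 0
    (fun n x hx => by rw [add_zero, add_zero]; exact haug n x hx)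
    (fun n x hx => by rw [add_zero]; exact hgdeg n x hx)
    (fun x => by
      obtain ⟨z, hz⟩ := Submodule.mkQ_surjective _ (e.symm (ε x))
      exact ⟨z, by rw [LinearMap.comp_apply, hz]; exact e.apply_symm_apply _⟩)
  -- The last clause of the invariant remembers that the map chosen at stage `0` is `k`. At that
  -- stage the obstruction vanishes by `ε ∂ = 0`, so vanishing of `M` is only needed for generators
  -- of `F_{i+2}`.
  obtain ⟨φ, hP, hR⟩ := exists_seq_of_step (α := fun i => F.X i →ₗ[S] D.carrier)
    (fun i φ => (∀ n x, x ∈ F.gr i n → φ x ∈ D.gr (n + -(i * a))) ∧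
      (∀ x, φ (F.d i x) ∈ LinearMap.range D.d) ∧ ∀ h : i = 0, ∀ x, φ x = k (h ▸ x))
    (fun i φ ψ => ∀ x, D.d (ψ x) = φ (F.d i x))
    ⟨(LinearMap.ker D.d).subtype ∘ₗ k, fun n x hx => by
      rw [Nat.cast_zero, zero_mul, neg_zero]
      exact hkdeg n x hx, fun x => hg0 _ (by rw [hk]; exact hε.apply_apply_eq_zero x),
      fun _ _ => rfl⟩ (by
      rintro i φ ⟨hdeg, hrange, -⟩
      obtain ⟨ψ, hψ, hψdeg⟩ := exists_graded_lift (F.isGraded (i + 1)) D.isGraded D.isGraded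
        (φ ∘ₗ F.d i) D.d (-(((i + 1 : ℕ) : ℤ) * a)) a (fun n x hx => by
          have := hdeg n _ (F.d_mem i n x hx)
          rwa [show n + -(((i + 1 : ℕ) : ℤ) * a) + a = n + -(i * a) by push_cast; ring])
        D.d_mem hrange
      refine ⟨ψ, ⟨hψdeg, ?_, fun h => absurd h (Nat.succ_ne_zero i)⟩, hψ⟩
      have hle : Submodule.span S
          {x | ∃ p : ℤ, (∀ m ∈ ℳ (p + -(((i + 1 : ℕ) : ℤ) * a)), m = 0) ∧
            x ∈ F.gr (i + 1 + 1) p} ≤ (LinearMap.range D.d).comap (ψ ∘ₗ F.d (i + 1)) := by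
        rw [Submodule.span_le]
        rintro x ⟨p, hp, hx⟩
        have hcyc : D.d (ψ (F.d (i + 1) x)) = 0 := by
          rw [hψ, LinearMap.comp_apply, F.d_d, map_zero]
        exact hg0 ⟨_, hcyc⟩ (hp _ (hgdeg _ _ (hψdeg p _ (F.d_mem (i + 1) p x hx))))
      rw [hvan i] at hle
      exact fun x => hle trivial)
  have hφ0 : ∀ x, φ 0 x = k x := (hP 0).2.2 rfl
  refine ⟨F.foldHom D φ (fun i => (hP i).1) (fun x => by rw [hφ0]; exact (k x).2) hR,
    F.isQuasiIso_of_resolution hF hε hsurj D e _ k hk fun x => ?_⟩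
  rw [foldHom_lof, hφ0]

end GradedComplex

/-- For `M` of finite length and `|a| ≫ 0`, folds of minimal resolutions of `M` map
quasi-isomorphically to all degree `a` differential modules with homology `M`. -/
theorem exists_bound_isQuasiIso [GradedRing 𝒜] [IsNoetherianRing S] [IsLocalRing (𝒜 0)]
    {M : Type w} [AddCommGroup M] [Module S M] {ℳ : ℤ → AddSubgroup M}
    (hℳ : IsGradedModule 𝒜 ℳ) (hM : IsFiniteLength S M) :
    ∃ N : ℕ, ∀ a : ℤ, (N : ℤ) ≤ |a| →
      ∀ (F : GradedComplex.{u, v} 𝒜) (ε : F.X 0 →ₗ[S] M), IsMinimalFreeResolution F ℳ ε →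
        ∀ D : GradedDM.{u, u'} 𝒜 a, D.HasHomology ℳ → ∃ φ : (F.fold a).Hom D, φ.IsQuasiIso := by
  obtain ⟨_, _⟩ := isFiniteLength_iff_isNoetherian_isArtinian.mp hM
  obtain ⟨K, hK⟩ := KoszulMatrix.exists_kills 𝒜
  obtain ⟨E, hE⟩ := K.exists_boundedOn_top hK (isGradedModule_ringGr (𝒜 := 𝒜))
  obtain ⟨b, hb⟩ := K.exists_boundedOn_top hK hℳ
  obtain ⟨B, hB⟩ := hℳ.exists_bound_of_artinian (LinearMap.id : M →ₗ[S] M)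
    (fun n x hx => by rw [LinearMap.id_apply] at hx ⊢; rw [hx, map_zero])
  have hB' : ∀ (n : ℤ) (x : M), (B : ℤ) ≤ |n| → x ∈ ℳ n → x = 0 := hB
  -- Generators of `F_{i+2}` have degree `p` in `[-B, b + (i+2)E]`, and `M` vanishes in degrees of
  -- absolute value at least `B`. This constant makes `p - (i+1)a ≤ -B` for `a ≥ 0` and `p - (i+1)a
  -- ≥ B` for `a ≤ 0`, using `i + 2 ≤ 2(i + 1)`.
  refine ⟨b + 2 * E + 2 * B, fun a ha F ε hF D hD => ?_⟩
  refine F.exists_isQuasiIso hℳ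
    (fun i => have := hF.free i; Module.Projective.of_free)
    hF.exact hF.exact_zero hF.surjective hF.aug_mem (fun i => ?_) D hD
  rw [eq_top_iff, ← hF.span_eq_top hℳ K hE hb (c := -B) (fun n x hn hx =>
    hB' n x (by rw [abs_of_neg (by omega)]; omega) hx) (i + 1 + 1)]
  refine Submodule.span_mono ?_
  rintro x ⟨p, hp1, hp2, hx⟩
  refine ⟨p, fun m hm => hB' _ m ?_ hm, hx⟩
  push_cast at hp2 ha ⊢
  have hi : (0 : ℤ) ≤ i := Int.natCast_nonneg i
  have hE0 : (0 : ℤ) ≤ E := Int.natCast_nonneg E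
  have hB0 : (0 : ℤ) ≤ B := Int.natCast_nonneg B
  have hb0 : (0 : ℤ) ≤ b := Int.natCast_nonneg b
  rcases le_total 0 a with h | h
  · rw [abs_of_nonneg h] at ha
    have h1 : 0 ≤ (i : ℤ) * (a - 2 * E) := mul_nonneg hi (by omega)
    have h2 : 0 ≤ (i : ℤ) * E := mul_nonneg hi hE0
    refine le_trans ?_ (neg_le_abs _)
    linarith
  · rw [abs_of_nonpos h] at ha
    have h1 : 0 ≤ (i : ℤ) * (-a) := mul_nonneg hi (by omega)
    refine le_trans ?_ (le_abs_self _)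
    linarith

end GradedDiff

end

theorem mainTheorem7 {S : Type u} [CommRing S] (𝒜 : ℕ → AddSubgroup S) [GradedRing 𝒜]
    [IsNoetherianRing S] [IsLocalRing (𝒜 0)] :
    (∀ F : GradedDiff.GradedComplex.{u, v} 𝒜, F.IsFiniteFree → F.HasFiniteLengthHomology →
      ∃ N : ℕ, ∀ a : ℤ, (N : ℤ) ≤ |a| → F.IsRigid a) ∧
    (∀ (M : Type w) [AddCommGroup M] [Module S M] (ℳ : ℤ → AddSubgroup M),
      GradedDiff.IsGradedModule 𝒜 ℳ → IsFiniteLength S M →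
      ∃ N : ℕ, ∀ a : ℤ, (N : ℤ) ≤ |a| →
        ∀ (F : GradedDiff.GradedComplex.{u, v} 𝒜) (ε : F.X 0 →ₗ[S] M),
          GradedDiff.IsMinimalFreeResolution F ℳ ε →
          ∀ D : GradedDiff.GradedDM.{u, u'} 𝒜 a, D.HasHomology ℳ →
            ∃ φ : (F.fold a).Hom D, φ.IsQuasiIso) := by
  exact ⟨fun F hF hH => hF.exists_isRigid hH,
    fun M _ _ ℳ hℳ hM => GradedDiff.exists_bound_isQuasiIso hℳ hM⟩
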